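/- All graphs are simple and undirected. An immersion of a graph $G$ into a graph $H$ is a graph morphism $G\to H$ that is injective on vertices; it is strong if it is an isomorphism of $G$ onto an induced subgraph of $H$. A graph is rayless if it contains no one-way infinite path. For an infinite cardinal $\kappa$ and a family $\mathcal K$ of graphs, let $\mathbf A_\kappa(\mathcal K)$ be the class of connected rayless graphs $G$ with at most $\kappa$ vertices such that no member of $\mathcal K$ has an immersion into $G$. A family $\mathcal F\subseteq\mathcal C$ is strongly universal in a class $\mathcal C$ of graphs if every member of $\mathcal C$ has a strong immersion into some member of $\mathcal F$; if such a family exists, the strong complexity $\operatorname{Stc}(\mathcal C)$ is the least cardinality of one. A subdivision of a star is a graph obtained from a finite star $K_{1,n}$, $n\ge 0$, by replacing edges by paths (so single vertices and finite paths are included). Theorem. Let $\kappa$ be an infinite cardinal and $\mathcal K$ a finite family of finite graphs. (1) If every member of $\mathcal K$ has a connected component that is not a subdivision of a star (for connected members: if no member of $\mathcal K$ is a subdivision of a star), then $\mathbf A_\kappa(\mathcal K)$ has a strongly universal family and $\operatorname{Stc}(\mathbf A_\kappa(\mathcal K))=\kappa^+$. (2) Otherwise, that is, if some member of $\mathcal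 K$ is a (possibly empty) disjoint union of subdivisions of stars (for example, a subdivision of a star), $\mathbf A_\kappa(\mathcal K)$ has a strongly universal family and $\operatorname{Stc}(\mathbf A_\kappa(\mathcal K))\le\aleph_0$. -/

import Mathlib

universe u

namespace RaylessGraphs

open Cardinal

/-- A (simple, undirected) graph bundled with its vertex set. -/
structure BGraph : Type (u + 1) where
  /-- the vertex set -/
  V : Type u
  /-- the graph on it -/
  G : SimpleGraph V

/-- A graph is rayless if it contains no ray, i.e. no one-way infinite path. -/
def IsRayless {V : Type u} (G : SimpleGraph V) : Prop :=
  ¬ ∃ r : ℕ → V, Function.Injective r ∧ ∀ n, G.Adj (r n) (r (n + 1))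

/-- The `κ`-rayless graphs: connected rayless graphs with at most `κ` vertices. -/
def raylessClass (κ : Cardinal.{u}) : Set BGraph.{u} :=
  {H | H.G.Connected ∧ IsRayless H.G ∧ #H.V ≤ κ}

/-- The `κ`-rayless graphs that are `K`-free for every `K ∈ 𝒦`. Here `K.G.Free H.G` says that
there is no immersion from `K` to `H`, i.e. no graph morphism that is injective on vertices. -/
def raylessFreeClass (κ : Cardinal.{u}) (𝒦 : Set BGraph.{u}) : Set BGraph.{u} :=
  {H | H ∈ raylessClass κ ∧ ∀ K ∈ 𝒦, K.G.Free H.G}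

/-- A family `F ⊆ C` is strongly universal in `C` if every member of `C` has a strong immersion
(an isomorphism onto an induced subgraph) into some member of `F`. -/
def IsStronglyUniversal (C F : Set BGraph.{u}) : Prop :=
  F ⊆ C ∧ ∀ H ∈ C, ∃ H' ∈ F, Nonempty (H.G ↪g H'.G)

/-- The class `C` admits a strongly universal family, and `c` is the least cardinality of one. -/
def IsStrongComplexity (C : Set BGraph.{u}) (c : Cardinal.{u + 1}) : Prop :=
  IsLeast {d : Cardinal.{u + 1} | ∃ F : Set BGraph.{u}, IsStronglyUniversal C F ∧ #F = d} c

/-- The subdivision of the star with `n` edges in which the `i`-th edge receives `ℓ i` new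
vertices. The centre is `none`; the `i`-th edge becomes the path
`none, some ⟨i, 0⟩, …, some ⟨i, ℓ i⟩`, whose last vertex is the `i`-th leaf. -/
def subdividedStar (n : ℕ) (ℓ : Fin n → ℕ) :
    SimpleGraph (Option (Σ i : Fin n, Fin (ℓ i + 1))) :=
  SimpleGraph.fromRel fun x y =>
    (∃ i, x = none ∧ y = some ⟨i, 0⟩) ∨
      ∃ i, ∃ j : Fin (ℓ i), x = some ⟨i, j.castSucc⟩ ∧ y = some ⟨i, j.succ⟩

/-- `G` is (isomorphic to) a subdivision of a finite star. The star with no edges, a single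
vertex, is included, and so are all finite paths. -/
def IsStarSubdivision {V : Type u} (G : SimpleGraph V) : Prop :=
  ∃ (n : ℕ) (ℓ : Fin n → ℕ), Nonempty (G ≃g subdividedStar n ℓ)

end RaylessGraphs

/-! A connected rayless graph can be dismantled: delete a vertex, then a vertex of each remaining
component, and so on; a dismantling that never ends would trace a ray. This yields an ordinal rank,
and regularity of κ⁺ keeps it below κ⁺ for graphs with at most κ vertices
(`exists_rankLT_of_rayless`).

Upper bounds. Induction on the rank α shows that at most max(ℵ₀, |α|) graphs suffice for rank less
than α (`hasFamily_rankLT`), provided the induction also preserves which finite labelled patterns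
immerse; this keeps the universal graphs inside the class. After deletion of x, each component is
labelled by adjacency to x and captured by induction. Only finitely many profiles exist. Components
whose profile occurs finitely often are recorded one by one; for a profile that occurs infinitely
often, κ copies of every available graph with that profile are taken. No new pattern appears, since
a finite pattern meets finitely many parts, which can be matched with distinct components of the
same profiles (`HasFamily.step`). Over all ranks below κ⁺ this gives κ⁺ graphs.

If a union of subdivided stars is excluded, there are no infinitely many disjoint large spiders, so
a finite set S meets all large spiders. Without large spiders the rank is finite, and restoring S
adds at most |S|; all ranks are thus bounded by ω + ω (`rankLT_of_free_stars`), and countably many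
graphs suffice.

Lower bound. At most κ graphs of the class lie together in one rayless graph D with at most κ
vertices. The tree of finite paths of D is rayless but, by a diagonal argument, does not immerse in
D (`pathTree_free`). Repeating every entry m times spreads the branching vertices so far apart that
connected subgraphs with at most m vertices are subdivided stars (`isStarSubdivision_of_immersion`),
so the tree belongs to the class when every excluded graph has a component of another kind. -/

namespace RaylessGraphs

open Cardinal

/-! ### Components of vertex sets and induction over rayless graphs -/

section Components

variable {V : Type u} {G : SimpleGraph V}

/-- `Y` is the vertex set of a connected component of `G[Z]`. -/
structure IsComp (G : SimpleGraph V) (Z Y : Set V) : Prop where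
  subset : Y ⊆ Z
  conn : (G.induce Y).Connected
  closed : ∀ y ∈ Y, ∀ z ∈ Z, G.Adj y z → z ∈ Y

/-- A nonempty set that is closed under adjacency inside a connected set is everything. -/
theorem subset_of_connected_of_closed {X D : Set V} (hX : (G.induce X).Connected) {d : V}
    (hdX : d ∈ X) (hd : d ∈ D) (hcl : ∀ y ∈ D, ∀ z ∈ X, G.Adj y z → z ∈ D) : X ⊆ D := by
  intro x hx
  obtain ⟨w⟩ := hX.preconnected ⟨d, hdX⟩ ⟨x, hx⟩
  have key : ∀ (a b : X), (G.induce X).Walk a b → (a : V) ∈ D → (b : V) ∈ D := by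
    intro a b w
    induction w with
    | nil => exact id
    | @cons a b c h _ ih => exact fun ha => ih (hcl _ ha _ b.2 h)
  exact key _ _ w hd

/-- Every connected subset of `Z` lies in a component of `Z`. -/
theorem exists_isComp_superset {Z Y : Set V} (hY : (G.induce Y).Connected) (hYZ : Y ⊆ Z) :
    ∃ D, IsComp G Z D ∧ Y ⊆ D := by
  obtain ⟨⟨y, hy⟩⟩ := hY.nonempty
  let c := (G.induce Z).connectedComponentMk ⟨y, hYZ hy⟩
  have hcl : ∀ a ∈ Subtype.val '' c.supp, ∀ b ∈ Z, G.Adj a b → b ∈ Subtype.val '' c.supp := by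
    rintro _ ⟨a, ha, rfl⟩ b hb hab
    refine ⟨⟨b, hb⟩, ?_, rfl⟩
    exact (SimpleGraph.ConnectedComponent.mem_supp_congr_adj c (v := a) (w := ⟨b, hb⟩) hab).1 ha
  refine ⟨Subtype.val '' c.supp, ⟨?_, ?_, hcl⟩, ?_⟩
  · rintro _ ⟨a, -, rfl⟩; exact a.2
  · have h := c.connected_toSimpleGraph
    let f : c.toSimpleGraph →g G.induce (Subtype.val '' c.supp) :=
      { toFun := fun a => ⟨a.1.1, a.1, a.2, rfl⟩
        map_rel' := fun {a b} hab => hab }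
    refine h.map f ?_
    rintro ⟨_, a, ha, rfl⟩
    exact ⟨⟨a, ha⟩, rfl⟩
  · refine subset_of_connected_of_closed hY hy ⟨⟨y, hYZ hy⟩, rfl, rfl⟩ ?_
    exact fun a ha b hb hab => hcl a ha b (hYZ hb) hab

theorem connected_induce_singleton (v : V) : (G.induce {v}).Connected := by
  have : Unique ({v} : Set V) := Set.uniqueSingleton v
  have : Nonempty ({v} : Set V) := ⟨default⟩
  exact ⟨SimpleGraph.Preconnected.of_subsingleton⟩

theorem exists_isComp_mem {Z : Set V} {v : V} (hv : v ∈ Z) : ∃ D, IsComp G Z D ∧ v ∈ D := by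
  obtain ⟨D, hD, h⟩ := exists_isComp_superset (connected_induce_singleton (G := G) v)
    (Set.singleton_subset_iff.2 hv)
  exact ⟨D, hD, h rfl⟩

theorem IsComp.nonempty {Z Y : Set V} (h : IsComp G Z Y) : Y.Nonempty := by
  obtain ⟨⟨y, hy⟩⟩ := h.conn.nonempty
  exact ⟨y, hy⟩

theorem IsComp.eq_of_mem {Z Y Y' : Set V} (h : IsComp G Z Y) (h' : IsComp G Z Y') {v : V}
    (hv : v ∈ Y) (hv' : v ∈ Y') : Y = Y' := by
  apply subset_antisymm
  · exact subset_of_connected_of_closed h.conn hv hv'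
      fun a ha b hb hab => h'.closed a ha b (h.subset hb) hab
  · exact subset_of_connected_of_closed h'.conn hv' hv
      fun a ha b hb hab => h.closed a ha b (h'.subset hb) hab

/-- If `X` is connected, every component of `X \ {x}` contains a neighbour of `x`. -/
theorem IsComp.exists_adj {X Y : Set V} {x : V} (hX : (G.induce X).Connected) (hx : x ∈ X)
    (h : IsComp G (X \ {x}) Y) : ∃ y ∈ Y, G.Adj x y := by
  by_contra! hno
  obtain ⟨d, hd⟩ := h.nonempty
  have : X ⊆ Y := by
    refine subset_of_connected_of_closed hX (h.subset hd).1 hd ?_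
    intro a ha b hb hab
    refine h.closed a ha b ⟨hb, ?_⟩ hab
    rintro rfl
    exact hno a ha hab.symm
  exact (h.subset (this hx)).2 rfl

/-- Induction over the connected vertex sets of a rayless graph. -/
theorem rayless_induction (hG : IsRayless G) {P : Set V → Prop}
    (hP : ∀ X : Set V, (G.induce X).Connected → ∀ x ∈ X,
      (∀ Y, IsComp G (X \ {x}) Y → P Y) → P X)
    (X : Set V) (hX : (G.induce X).Connected) : P X := by
  by_contra hPX
  -- A bad set with a marked vertex x leaves a bad component, which contains a neighbour of x; mark
  -- that neighbour and repeat. The marked vertices form a ray, without repetition because x is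
  -- absent from all later sets.
  let St := {s : Set V × V // (G.induce s.1).Connected ∧ s.2 ∈ s.1 ∧ ¬ P s.1}
  have step : ∀ s : St, ∃ t : St, t.1.1 ⊆ s.1.1 \ {s.1.2} ∧ G.Adj s.1.2 t.1.2 := by
    rintro ⟨⟨Z, x⟩, hZ, hx, hPZ⟩
    have h1 : ∃ Y, IsComp G (Z \ {x}) Y ∧ ¬ P Y := by
      by_contra! hall
      exact hPZ (hP Z hZ x hx hall)
    obtain ⟨Y, hY, hPY⟩ := h1
    obtain ⟨y, hy, hxy⟩ := hY.exists_adj hZ hx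
    exact ⟨⟨⟨Y, y⟩, hY.conn, hy, hPY⟩, hY.subset, hxy⟩
  choose nx hsub hadj using step
  obtain ⟨⟨x, hx⟩⟩ := hX.nonempty
  let s : ℕ → St := fun n => Nat.rec ⟨⟨X, x⟩, hX, hx, hPX⟩ (fun _ t => nx t) n
  have hmono : ∀ m n, m ≤ n → (s n).1.1 ⊆ (s m).1.1 := by
    intro m n hmn
    induction hmn with
    | refl => exact subset_rfl
    | step _ ih => exact ((hsub _).trans Set.sdiff_subset).trans ih
  have hne : ∀ m n, m < n → (s m).1.2 ≠ (s n).1.2 := by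
    intro m n hmn he
    have h1 : (s n).1.2 ∈ (s (m + 1)).1.1 := hmono _ _ hmn (s n).2.2.1
    exact (hsub (s m) h1).2 he.symm
  refine hG ⟨fun n => (s n).1.2, ?_, fun n => hadj (s n)⟩
  intro m n hmn
  rcases lt_trichotomy m n with h | h | h
  · exact absurd hmn (hne _ _ h)
  · exact h
  · exact absurd hmn.symm (hne _ _ h)

end Components

/-! ### The rank of a connected vertex set -/

section Rank

variable {V : Type u} {G : SimpleGraph V}

/-- `X` has rank less than `α`, where the rank of a connected set bounds strictly the ranks of the
connected sets that are left when a suitable vertex is deleted. -/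
def RankLT (G : SimpleGraph V) (α : Ordinal.{u}) (X : Set V) : Prop :=
  ∃ β, ∃ _ : β < α, ∃ x ∈ X, ∀ Y ⊆ X \ {x}, (G.induce Y).Connected → RankLT G β Y
termination_by α

theorem rankLT_iff {α : Ordinal.{u}} {X : Set V} : RankLT G α X ↔
    ∃ β < α, ∃ x ∈ X, ∀ Y ⊆ X \ {x}, (G.induce Y).Connected → RankLT G β Y := by
  rw [RankLT]
  simp only [exists_prop]

theorem RankLT.mono {α β : Ordinal.{u}} {X : Set V} (h : RankLT G α X) (hαβ : α ≤ β) :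
    RankLT G β X := by
  rw [rankLT_iff] at h ⊢
  obtain ⟨γ, hγ, h⟩ := h
  exact ⟨γ, hγ.trans_le hαβ, h⟩

theorem RankLT.subset {α : Ordinal.{u}} {X Y : Set V} (h : RankLT G α X) (hYX : Y ⊆ X)
    (hY : (G.induce Y).Connected) : RankLT G α Y := by
  obtain ⟨β, hβ, x, hx, h'⟩ := rankLT_iff.1 h
  by_cases hxY : x ∈ Y
  · exact rankLT_iff.2 ⟨β, hβ, x, hxY, fun Z hZ => h' Z fun z hz => ⟨hYX (hZ hz).1, (hZ hz).2⟩⟩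
  · refine (h' Y (fun y hy => ⟨hYX hy, ?_⟩) hY).mono hβ.le
    rintro rfl
    exact hxY hy

/-- Components suffice because every connected set lies in one and the rank is monotone under
connected subsets. -/
theorem rankLT_succ_of_isComp {α : Ordinal.{u}} {X : Set V} {x : V} (hx : x ∈ X)
    (h : ∀ Y, IsComp G (X \ {x}) Y → RankLT G α Y) : RankLT G (Order.succ α) X := by
  refine rankLT_iff.2 ⟨α, Order.lt_succ α, x, hx, fun Y hY hYc => ?_⟩
  obtain ⟨D, hD, hYD⟩ := exists_isComp_superset hYc hY
  exact (h D hD).subset hYD hYc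

/-- Deleting finitely many vertices changes the rank by a finite amount. -/
theorem RankLT.of_finset {α : Ordinal.{u}} (S : Finset V) : ∀ {X : Set V},
    (G.induce X).Connected →
    (∀ Y ⊆ X \ (S : Set V), (G.induce Y).Connected → RankLT G α Y) →
    RankLT G (α + (S.card : Ordinal.{u})) X := by
  classical
  induction S using Finset.induction_on with
  | empty =>
    intro X hX h
    simpa using h X (by simp) hX
  | insert s S hs ih =>
    intro X hX h
    rw [Finset.card_insert_of_notMem hs, Nat.cast_succ, ← add_assoc, ← Order.succ_eq_add_one]
    have hall : ∀ Y ⊆ X \ {s}, (G.induce Y).Connected → RankLT G (α + (S.card : Ordinal.{u})) Y := by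
      intro Y hY hYc
      refine ih hYc fun Z hZ hZc => h Z ?_ hZc
      intro z hz
      have h1 := hZ hz
      have h2 := hY h1.1
      refine ⟨h2.1, ?_⟩
      have h3 : z ≠ s := h2.2
      have h4 : z ∉ S := h1.2
      simp [h3, h4]
    by_cases hsX : s ∈ X
    · exact rankLT_iff.2 ⟨_, Order.lt_succ _, s, hsX, hall⟩
    · exact (hall X (fun x hx => ⟨hx, fun hxs => hsX (hxs ▸ hx)⟩) hX).mono (Order.le_succ _)

/-- The rank of a rayless graph with at most `κ` vertices is less than `κ⁺`. -/
theorem exists_rankLT_of_rayless {κ : Cardinal.{u}} (hκ : ℵ₀ ≤ κ) (hG : IsRayless G)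
    (hV : #V ≤ κ) (X : Set V) (hX : (G.induce X).Connected) :
    ∃ α < (Order.succ κ).ord, RankLT G α X := by
  refine rayless_induction hG (P := fun X => ∃ α < (Order.succ κ).ord, RankLT G α X) ?_ X hX
  intro X hX x hx hY
  choose! f hf hfr using hY
  let I := {Y : Set V // IsComp G (X \ {x}) Y}
  -- Disjoint components have distinct representatives, so at most κ ranks enter the supremum, which
  -- stays below the regular cardinal κ⁺.
  have hI : #I ≤ κ := by
    refine le_trans (Cardinal.mk_le_of_injective (f := fun Y : I => Y.2.nonempty.some) ?_) hV
    rintro ⟨Y, hY⟩ ⟨Y', hY'⟩ h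
    refine Subtype.ext (hY.eq_of_mem hY' hY.nonempty.some_mem ?_)
    change hY.nonempty.some = hY'.nonempty.some at h
    rw [h]
    exact hY'.nonempty.some_mem
  have hreg := Cardinal.isRegular_succ hκ
  have hsup : (⨆ Y : I, f Y.1) < (Order.succ κ).ord := by
    refine Ordinal.iSup_lt_of_lt_cof ?_ fun Y => hf _ Y.2
    rw [hreg.cof_ord]
    exact Order.lt_succ_of_le hI
  refine ⟨Order.succ (⨆ Y : I, f Y.1), ?_, rankLT_succ_of_isComp hx fun Y hY => ?_⟩
  · exact (Cardinal.isSuccLimit_ord hreg.aleph0_le).succ_lt hsup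
  · exact (hfr Y hY).mono (Ordinal.le_iSup (fun Y : I => f Y.1) ⟨Y, hY⟩)

end Rank

/-! ### Excluding unions of stars bounds the rank by ω + ω -/

section Spiders

variable {V : Type u} {G : SimpleGraph V}

/-- `f` is an immersion into `G[X]` of the spider with `n` legs of length `l + 1`. -/
structure IsSpider (G : SimpleGraph V) (X : Set V) (n l : ℕ)
    (f : Option (Fin n × Fin (l + 1)) → V) : Prop where
  mem : ∀ a, f a ∈ X
  inj : Function.Injective f
  adj_zero : ∀ i, G.Adj (f none) (f (some (i, 0)))
  adj_succ : ∀ i (j : Fin l), G.Adj (f (some (i, j.castSucc))) (f (some (i, j.succ)))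

/-- A connected set of rank at least `k` contains a path with `k` vertices from every vertex. -/
theorem exists_path_or_rankLT (k : ℕ) : ∀ {X : Set V}, (G.induce X).Connected → ∀ u ∈ X,
    (∃ p : Fin (k + 1) → V, Function.Injective p ∧ p 0 = u ∧ (∀ j, p j ∈ X) ∧
      ∀ j : Fin k, G.Adj (p j.castSucc) (p j.succ)) ∨ RankLT G (k : Ordinal.{u}) X := by
  induction k with
  | zero =>
    intro X _ u hu
    exact Or.inl ⟨fun _ => u, fun a b _ => Subsingleton.elim (α := Fin 1) a b, rfl, fun _ => hu,
      fun j => j.elim0⟩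
  | succ k ih =>
    intro X hX u hu
    by_cases h : ∀ Y, IsComp G (X \ {u}) Y → RankLT G (k : Ordinal.{u}) Y
    · right
      rw [Nat.cast_succ, ← Order.succ_eq_add_one]
      exact rankLT_succ_of_isComp hu h
    · left
      push Not at h
      obtain ⟨Y, hY, hr⟩ := h
      obtain ⟨v, hv, huv⟩ := hY.exists_adj hX hu
      obtain ⟨p, hp, hp0, hpY, hadj⟩ := (ih hY.conn v hv).resolve_right hr
      refine ⟨Fin.cons u p, ?_, rfl, ?_, ?_⟩
      · rw [Fin.cons_injective_iff]
        refine ⟨?_, hp⟩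
        rintro ⟨j, hj⟩
        exact (hY.subset (hpY j)).2 hj
      · intro j
        refine Fin.cases hu (fun j => ?_) j
        exact (hY.subset (hpY j)).1
      · intro j
        refine Fin.cases ?_ (fun j => ?_) j
        · simpa [hp0] using huv
        · simpa [← Fin.succ_castSucc] using hadj j

/-- Connected sets in rayless graphs without a large spider have finite rank. -/
theorem exists_nat_rankLT_of_no_spider (hG : IsRayless G) (n l : ℕ) (X : Set V)
    (hX : (G.induce X).Connected) (hn : ∀ f, ¬ IsSpider G X n l f) :
    ∃ N : ℕ, RankLT G (N : Ordinal.{u}) X := by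
  revert hn
  refine rayless_induction hG
    (P := fun X => (∀ f, ¬ IsSpider G X n l f) → ∃ N : ℕ, RankLT G (N : Ordinal.{u}) X) ?_ X hX
  intro X hX x hx ih hn
  have ih' : ∀ Y, IsComp G (X \ {x}) Y → ∃ N : ℕ, RankLT G (N : Ordinal.{u}) Y := by
    intro Y hY
    refine ih Y hY fun f hf => hn f ⟨fun a => (hY.subset (hf.mem a)).1, hf.inj, hf.adj_zero,
      hf.adj_succ⟩
  choose! N hN using ih'
  -- `B` collects the components with a long path starting at a neighbour of x. Infinitely many of
  -- them would supply disjoint legs of a spider centred at x. Hence `B` is finite, and the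
  -- remaining components have rank less than l, which bounds the rank uniformly.
  let B : Set (Set V) := {Y | IsComp G (X \ {x}) Y ∧ ¬ RankLT G (l : Ordinal.{u}) Y}
  have hpath : ∀ Y ∈ B, ∃ p : Fin (l + 1) → V, Function.Injective p ∧ G.Adj x (p 0) ∧
      (∀ j, p j ∈ Y) ∧ ∀ j : Fin l, G.Adj (p j.castSucc) (p j.succ) := by
    rintro Y ⟨hY, hr⟩
    obtain ⟨y, hy, hxy⟩ := hY.exists_adj hX hx
    obtain ⟨p, h1, h2, h3, h4⟩ := (exists_path_or_rankLT l hY.conn y hy).resolve_right hr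
    exact ⟨p, h1, h2 ▸ hxy, h3, h4⟩
  have : Nonempty V := ⟨x⟩
  choose! p hp1 hp2 hp3 hp4 using hpath
  have hBfin : B.Finite := by
    by_contra hinf
    have hinf : B.Infinite := hinf
    let e := hinf.natEmbedding
    refine hn (fun a => a.elim x fun ij => p (e ij.1) ij.2) ⟨?_, ?_, ?_, ?_⟩
    · rintro (_ | ⟨i, j⟩)
      · exact hx
      · exact ((e i).2.1.subset (hp3 _ (e i).2 j)).1
    · have hne : ∀ i j, x ≠ p (e i) j := fun i j h =>
        ((e i).2.1.subset (hp3 _ (e i).2 j)).2 h.symm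
      rintro (_ | ⟨i, j⟩) (_ | ⟨i', j'⟩) h
      · rfl
      · exact absurd h (hne _ _)
      · exact absurd h.symm (hne _ _)
      · have h : p (e i) j = p (e i') j' := h
        have hY : (e i : Set V) = e i' := (e i).2.1.eq_of_mem (e i').2.1 (hp3 _ (e i).2 j)
          (h ▸ hp3 _ (e i').2 j')
        have hi : i = i' := Fin.ext (e.injective (Subtype.ext hY))
        subst hi
        rw [hp1 _ (e i).2 h]
    · exact fun i => hp2 _ (e i).2
    · exact fun i j => hp4 _ (e i).2 j
  refine ⟨max l (hBfin.toFinset.sup N) + 1, ?_⟩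
  rw [Nat.cast_succ, ← Order.succ_eq_add_one]
  refine rankLT_succ_of_isComp hx fun Y hY => ?_
  by_cases hYB : RankLT G (l : Ordinal.{u}) Y
  · exact hYB.mono (by exact_mod_cast le_max_left _ _)
  · refine (hN Y hY).mono ?_
    have : N Y ≤ hBfin.toFinset.sup N := Finset.le_sup (f := N) (by simpa using ⟨hY, hYB⟩)
    exact_mod_cast this.trans (le_max_right _ _)

/-- A subdivision of a star immerses into every large spider. -/
theorem IsSpider.exists_hom {X : Set V} {N : ℕ} {f : Option (Fin N × Fin (N + 1)) → V}
    (hf : IsSpider G X N N f) {n : ℕ} {ℓ : Fin n → ℕ} (hn : n ≤ N) (hℓ : ∀ i, ℓ i ≤ N) :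
    ∃ g : subdividedStar n ℓ →g G, Function.Injective g ∧ ∀ a, g a ∈ Set.range f := by
  let e : Option (Σ i : Fin n, Fin (ℓ i + 1)) → Option (Fin N × Fin (N + 1)) :=
    Option.map fun a => (Fin.castLE hn a.1, Fin.castLE (Nat.succ_le_succ (hℓ a.1)) a.2)
  have he : Function.Injective e := by
    refine Option.map_injective ?_
    rintro ⟨i, j⟩ ⟨i', j'⟩ h
    simp only [Prod.mk.injEq, Fin.castLE_inj] at h
    obtain ⟨rfl, h⟩ := h
    simpa using h
  have key : ∀ x y, ((∃ i, x = none ∧ y = some ⟨i, 0⟩) ∨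
      ∃ i, ∃ j : Fin (ℓ i), x = some ⟨i, j.castSucc⟩ ∧ y = some ⟨i, j.succ⟩) →
      G.Adj (f (e x)) (f (e y)) := by
    rintro x y (⟨i, rfl, rfl⟩ | ⟨i, j, rfl, rfl⟩)
    · exact hf.adj_zero _
    · exact hf.adj_succ (Fin.castLE hn i) (Fin.castLE (hℓ i) j)
  refine ⟨⟨fun a => f (e a), ?_⟩, hf.inj.comp he, fun a => ⟨e a, rfl⟩⟩
  rintro x y ⟨-, h | h⟩
  · exact key _ _ h
  · exact (key _ _ h).symm

/-- If `G` excludes a finite disjoint union of subdivided stars, then the deletion of some finite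
vertex set leaves no large spider. -/
theorem exists_finset_no_spider {W : Type u} {K : SimpleGraph W} [Finite W]
    (hK : ∀ c : K.ConnectedComponent, IsStarSubdivision c.toSimpleGraph) (hfree : K.Free G) :
    ∃ (N : ℕ) (S : Finset V), ∀ f, ¬ IsSpider G (S : Set V)ᶜ N N f := by
  classical
  choose n ℓ hℓ using hK
  have := Fintype.ofFinite W
  have := Fintype.ofFinite K.ConnectedComponent
  let N : ℕ := Finset.univ.sup fun c => max (n c) (Finset.univ.sup (ℓ c))
  have hN : ∀ c, max (n c) (Finset.univ.sup (ℓ c)) ≤ N := fun c =>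
    Finset.le_sup (f := fun c => max (n c) (Finset.univ.sup (ℓ c))) (Finset.mem_univ c)
  refine ⟨N, ?_⟩
  by_contra! hall
  -- If every finite set misses some spider, spiders can be chosen successively disjoint from all
  -- earlier ones. Each component of K then gets a spider of its own.
  obtain ⟨F, hF1, hF2⟩ := exists_seq_of_forall_finset_exists
    (fun f : Option (Fin N × Fin (N + 1)) → V => IsSpider G Set.univ N N f)
    (fun f g => ∀ a b, f a ≠ g b) (by
      intro s _
      obtain ⟨g, hg⟩ := hall (s.biUnion fun f => Finset.univ.image f)
      refine ⟨g, ⟨fun _ => trivial, hg.inj, hg.adj_zero, hg.adj_succ⟩, fun f hf a b hab => ?_⟩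
      refine hg.mem b ?_
      rw [← hab]
      simp only [Finset.coe_biUnion, Set.mem_iUnion]
      exact ⟨f, hf, by simp⟩)
  have hFinj : ∀ i j a b, F i a = F j b → i = j := by
    intro i j a b h
    rcases lt_trichotomy i j with hij | hij | hij
    · exact absurd h (hF2 _ _ hij _ _)
    · exact hij
    · exact absurd h.symm (hF2 _ _ hij _ _)
  let e := Fintype.equivFin K.ConnectedComponent
  have hg : ∀ c : K.ConnectedComponent, ∃ g : c.toSimpleGraph →g G, Function.Injective g ∧
      ∀ a, g a ∈ Set.range (F (e c)) := by
    intro c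
    obtain ⟨g, hg, hgr⟩ := (hF1 (e c)).exists_hom ((le_max_left _ _).trans (hN c))
      (fun i => (Finset.le_sup (f := ℓ c) (Finset.mem_univ i)).trans
        ((le_max_right _ _).trans (hN c)))
    obtain ⟨φ⟩ := hℓ c
    exact ⟨g.comp φ.toHom, hg.comp φ.injective, fun a => hgr _⟩
  choose g hginj hgr using hg
  have hgeq : ∀ (c : K.ConnectedComponent) (w : W) (hw : w ∈ c.supp),
      g (K.connectedComponentMk w) ⟨w, rfl⟩ = g c ⟨w, hw⟩ := by
    rintro c w rfl
    rfl
  refine hfree ⟨⟨⟨fun w => g (K.connectedComponentMk w) ⟨w, rfl⟩, ?_⟩, ?_⟩⟩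
  · intro a b hab
    have hb : b ∈ (K.connectedComponentMk a).supp :=
      SimpleGraph.ConnectedComponent.sound hab.symm.reachable
    rw [hgeq _ b hb]
    exact (g _).map_rel hab
  · intro a b hab
    change g (K.connectedComponentMk a) ⟨a, rfl⟩ = g (K.connectedComponentMk b) ⟨b, rfl⟩ at hab
    obtain ⟨s, hs⟩ := hgr _ ⟨a, rfl⟩
    obtain ⟨t, ht⟩ := hgr _ ⟨b, rfl⟩
    have hc : K.connectedComponentMk a = K.connectedComponentMk b :=
      e.injective (Fin.ext (hFinj _ _ s t (by rw [hs, ht, hab])))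
    rw [hgeq (K.connectedComponentMk a) b hc.symm] at hab
    exact congrArg Subtype.val (hginj _ hab)

/-- Rayless graphs excluding a finite disjoint union of subdivided stars have small rank. -/
theorem rankLT_of_free_stars {W : Type u} {K : SimpleGraph W} [Finite W]
    (hK : ∀ c : K.ConnectedComponent, IsStarSubdivision c.toSimpleGraph) (hfree : K.Free G)
    (hG : IsRayless G) (hc : G.Connected) :
    RankLT G (Ordinal.omega0 + Ordinal.omega0) Set.univ := by
  obtain ⟨N, S, hS⟩ := exists_finset_no_spider hK hfree
  have hu : (G.induce Set.univ).Connected := (SimpleGraph.induceUnivIso G).connected_iff.2 hc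
  refine (RankLT.of_finset (α := Ordinal.omega0) S hu fun Y hY hYc => ?_).mono ?_
  · obtain ⟨k, hk⟩ := exists_nat_rankLT_of_no_spider hG N N Y hYc fun f hf =>
      hS f ⟨fun a => (hY (hf.mem a)).2, hf.inj, hf.adj_zero, hf.adj_succ⟩
    exact hk.mono (Ordinal.natCast_lt_omega0 k).le
  · exact add_le_add_right (Ordinal.natCast_lt_omega0 _).le _

end Spiders

/-! ### Labelled graphs, profiles and assembly around a new vertex -/

section Labelled

/-- A graph with labelled vertices. -/
structure LGraph (Λ : Type) : Type (u + 1) where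
  /-- the vertex set -/
  V : Type u
  /-- the graph on it -/
  G : SimpleGraph V
  /-- the labels of the vertices -/
  lab : V → Λ

/-- A finite labelled graph whose vertices form a subset of `M`. -/
abbrev Pattern (M Λ : Type) : Type := Set M × SimpleGraph M × (M → Λ)

/-- The patterns that immerse into the labelled graph induced on `X`. -/
def profile (M : Type) {Λ : Type} {V : Type u} (G : SimpleGraph V) (lab : V → Λ) (X : Set V) :
    Set (Pattern M Λ) :=
  {p | ∃ f : M → V, (∀ a, f a ∈ X) ∧ Set.InjOn f p.1 ∧
    (∀ a ∈ p.1, ∀ b ∈ p.1, p.2.1.Adj a b → G.Adj (f a) (f b)) ∧ ∀ a ∈ p.1, lab (f a) = p.2.2 a}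

/-- The profile of a labelled graph. -/
def LGraph.profile (M : Type) {Λ : Type} (U : LGraph.{u} Λ) : Set (Pattern M Λ) :=
  RaylessGraphs.profile M U.G U.lab Set.univ

/-- The labelled graph induced on `X` embeds strongly in `U` and has the same profile. -/
def Captures (M : Type) {Λ : Type} {V : Type u} (U : LGraph.{u} Λ) (G : SimpleGraph V)
    (lab : V → Λ) (X : Set V) : Prop :=
  (∃ φ : G.induce X ↪g U.G, ∀ x, U.lab (φ x) = lab x) ∧ U.profile M = profile M G lab X

/-- The other inclusion is automatic: a label-preserving embedding carries every pattern along. -/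
theorem captures_of_subset {M Λ : Type} {V : Type u} {U : LGraph.{u} Λ} {G : SimpleGraph V}
    {lab : V → Λ} {X : Set V} (φ : G.induce X ↪g U.G) (hφ : ∀ x, U.lab (φ x) = lab x)
    (h : U.profile M ⊆ profile M G lab X) : Captures M U G lab X := by
  refine ⟨⟨φ, hφ⟩, h.antisymm ?_⟩
  rintro p ⟨f, hf, hinj, hadj, hlab⟩
  refine ⟨fun a => φ ⟨f a, hf a⟩, fun _ => trivial, ?_, ?_, ?_⟩
  · intro a ha b hb hab
    exact hinj ha hb (congrArg Subtype.val (φ.injective hab))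
  · exact fun a ha b hb hab => φ.map_rel_iff.2 (hadj a ha b hb hab)
  · intro a ha
    rw [hφ, hlab a ha]

/-- Membership in the class of labelled `κ`-rayless graphs. -/
structure LGraph.Good (κ : Cardinal.{u}) {Λ : Type} (U : LGraph.{u} Λ) : Prop where
  conn : U.G.Connected
  rayless : IsRayless U.G
  card : #U.V ≤ κ

/-- Every connected set satisfying `P` is captured by one of at most `μ` labelled graphs. -/
def HasFamily (κ μ : Cardinal.{u}) (M Λ : Type)
    (P : ∀ V : Type u, SimpleGraph V → Set V → Prop) : Prop :=
  ∃ (T : Type u) (U : T → LGraph.{u} Λ), #T ≤ μ ∧ (∀ t, (U t).Good κ) ∧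
    ∀ (V : Type u) (G : SimpleGraph V) (lab : V → Λ) (X : Set V), (G.induce X).Connected →
      #X ≤ κ → P V G X → ∃ t, Captures M (U t) G lab X

/-- The graph obtained from a vertex with label `c` and disjoint labelled graphs `C j` by joining
the new vertex to the vertices whose label has true second component. -/
def assemble {Λ : Type} (c : Λ) {J : Type u} (C : J → LGraph.{u} (Λ × Prop)) : LGraph.{u} Λ where
  V := Option (Σ j, (C j).V)
  G :=
    { Adj := fun a b => match a, b with
        | none, none => False
        | none, some v => ((C v.1).lab v.2).2
        | some v, none => ((C v.1).lab v.2).2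
        | some v, some w => ∃ h : v.1 = w.1, (C w.1).G.Adj (h ▸ v.2) w.2
      symm := ⟨by
        rintro (_ | ⟨i, v⟩) (_ | ⟨j, w⟩) h
        · exact h
        · exact h
        · exact h
        · obtain ⟨h, h'⟩ := h
          dsimp only at h
          subst h
          exact ⟨rfl, h'.symm⟩⟩
      loopless := ⟨by
        rintro (_ | ⟨i, v⟩) h
        · exact h
        · exact (C i).G.loopless.irrefl _ h.2⟩ }
  lab := fun a => match a with
    | none => c
    | some v => ((C v.1).lab v.2).1

section Assemble

variable {Λ : Type} (c : Λ) {J : Type u} (C : J → LGraph.{u} (Λ × Prop))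

theorem assemble_adj_none (j : J) (v : (C j).V) :
    (assemble c C).G.Adj none (some ⟨j, v⟩) ↔ ((C j).lab v).2 := Iff.rfl

theorem assemble_none_adj (j : J) (v : (C j).V) :
    (assemble c C).G.Adj (some ⟨j, v⟩) none ↔ ((C j).lab v).2 := Iff.rfl

theorem assemble_adj_some (j : J) (v w : (C j).V) :
    (assemble c C).G.Adj (some ⟨j, v⟩) (some ⟨j, w⟩) ↔ (C j).G.Adj v w :=
  ⟨fun h => h.2, fun h => ⟨rfl, h⟩⟩

theorem assemble_eq_of_adj {i j : J} {v : (C i).V} {w : (C j).V}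
    (h : (assemble c C).G.Adj (some ⟨i, v⟩) (some ⟨j, w⟩)) : i = j := h.1

theorem assemble_card {κ : Cardinal.{u}} (hκ : ℵ₀ ≤ κ) (hJ : #J ≤ κ) (hC : ∀ j, #(C j).V ≤ κ) :
    #(assemble c C).V ≤ κ := by
  change #(Option (Σ j, (C j).V)) ≤ κ
  rw [Cardinal.mk_option, Cardinal.mk_sigma]
  refine Cardinal.add_le_of_le hκ ?_ ((Cardinal.one_lt_aleph0.le).trans hκ)
  refine (Cardinal.sum_le_mk_mul_iSup _).trans ?_
  exact Cardinal.mul_le_of_le hκ hJ (ciSup_le' hC)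

/-- A ray passes through the new vertex at most once, so a tail of it stays within a single part. -/
theorem assemble_rayless (hC : ∀ j, IsRayless (C j).G) : IsRayless (assemble c C).G := by
  rintro ⟨r, hr, hadj⟩
  have h1 : ∃ N, ∀ n, N ≤ n → r n ≠ none := by
    by_cases h : ∃ N, r N = none
    · obtain ⟨N, hN⟩ := h
      refine ⟨N + 1, fun n hn h => ?_⟩
      have := hr (h.trans hN.symm)
      omega
    · push Not at h
      exact ⟨0, fun n _ => h n⟩
  obtain ⟨N, hN⟩ := h1
  obtain ⟨⟨j, v₀⟩, hv₀⟩ := Option.ne_none_iff_exists'.1 (hN N le_rfl)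
  have h2 : ∀ k, ∃ v : (C j).V, r (N + k) = some ⟨j, v⟩ := by
    intro k
    induction k with
    | zero => exact ⟨v₀, hv₀⟩
    | succ k ih =>
      obtain ⟨v, hv⟩ := ih
      obtain ⟨⟨i, w⟩, hw⟩ := Option.ne_none_iff_exists'.1 (hN (N + (k + 1)) (by omega))
      have := hadj (N + k)
      rw [hv, add_assoc, hw] at this
      obtain rfl := assemble_eq_of_adj c C this
      exact ⟨w, hw⟩
  choose s hs using h2
  refine hC j ⟨s, fun a b hab => ?_, fun n => ?_⟩
  · have : r (N + a) = r (N + b) := by rw [hs, hs, hab]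
    have := hr this
    omega
  · have := hadj (N + n)
    rw [hs, add_assoc, hs, assemble_adj_some] at this
    exact this

theorem assemble_connected (hC : ∀ j, (C j).G.Connected) (h : ∀ j, ∃ v, ((C j).lab v).2) :
    (assemble c C).G.Connected := by
  rw [SimpleGraph.connected_iff_exists_forall_reachable]
  refine ⟨none, ?_⟩
  rintro (_ | ⟨j, v⟩)
  · exact SimpleGraph.Reachable.refl _
  · obtain ⟨w, hw⟩ := h j
    have h1 : (assemble c C).G.Adj none (some ⟨j, w⟩) := hw
    let f : (C j).G →g (assemble c C).G :=
      ⟨fun v => some ⟨j, v⟩, fun {a b} hab => (assemble_adj_some c C j a b).2 hab⟩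
    exact h1.reachable.trans (((hC j).preconnected w v).map f)

variable {M : Type} {V : Type u} {G : SimpleGraph V} {lab : V → Λ} {X : Set V} {x : V}

/-- If the components of `G[X] - x` are captured by distinct members of `C`, then `G[X]` embeds
in the assembled graph. -/
theorem exists_embedding_assemble
    (e : {Y : Set V // IsComp G (X \ {x}) Y} → J) (he : Function.Injective e)
    (h : ∀ Y, ∃ φ : G.induce Y.1 ↪g (C (e Y)).G, ∀ v, (C (e Y)).lab (φ v) = (lab v, G.Adj x v)) :
    ∃ φ : G.induce X ↪g (assemble (lab x) C).G, ∀ v, (assemble (lab x) C).lab (φ v) = lab v := by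
  classical
  choose φ hφ using h
  have hD : ∀ v : X, (v : V) ≠ x → ∃ Y : {Y : Set V // IsComp G (X \ {x}) Y}, (v : V) ∈ Y.1 := by
    intro v hv
    obtain ⟨D, hD, hvD⟩ := exists_isComp_mem (G := G) (Z := X \ {x}) (v := v) ⟨v.2, hv⟩
    exact ⟨⟨D, hD⟩, hvD⟩
  choose D hD using hD
  let Φ : X → (assemble (lab x) C).V := fun v =>
    if h : (v : V) = x then none else some ⟨e (D v h), φ (D v h) ⟨v, hD v h⟩⟩
  have hΦx : ∀ v : X, (v : V) = x → Φ v = none := fun v hv => dif_pos hv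
  have hΦ : ∀ (v : X) (Y : {Y : Set V // IsComp G (X \ {x}) Y}) (hv : (v : V) ∈ Y.1),
      Φ v = some ⟨e Y, φ Y ⟨v, hv⟩⟩ := by
    intro v Y hv
    have hvx : (v : V) ≠ x := (Y.2.subset hv).2
    have hDY : D v hvx = Y := Subtype.ext ((D v hvx).2.eq_of_mem Y.2 (hD v hvx) hv)
    subst hDY
    exact dif_neg hvx
  have hcases : ∀ v : X, (v : V) = x ∨ ∃ Y : {Y : Set V // IsComp G (X \ {x}) Y}, (v : V) ∈ Y.1 :=
    fun v => or_iff_not_imp_left.2 fun hv => ⟨D v hv, hD v hv⟩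
  have hxY : ∀ (Y : {Y : Set V // IsComp G (X \ {x}) Y}) (v : Y.1),
      ((C (e Y)).lab (φ Y v)).2 ↔ G.Adj x v := by
    intro Y v
    rw [hφ]
  refine ⟨⟨⟨Φ, ?_⟩, ?_⟩, ?_⟩
  · intro v w hvw
    rcases hcases v with hv | ⟨Y, hv⟩ <;> rcases hcases w with hw | ⟨Z, hw⟩
    · exact Subtype.ext (hv.trans hw.symm)
    · rw [hΦx v hv, hΦ w Z hw] at hvw; cases hvw
    · rw [hΦx w hw, hΦ v Y hv] at hvw; cases hvw
    · rw [hΦ v Y hv, hΦ w Z hw] at hvw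
      have hYZ : Y = Z := he (congrArg Sigma.fst (Option.some.inj hvw))
      subst hYZ
      have h1 := eq_of_heq (Sigma.mk.inj (Option.some.inj hvw)).2
      exact Subtype.ext (Subtype.mk.inj ((φ Y).injective h1))
  · intro v w
    change (assemble (lab x) C).G.Adj (Φ v) (Φ w) ↔ G.Adj v w
    rcases hcases v with hv | ⟨Y, hv⟩ <;> rcases hcases w with hw | ⟨Z, hw⟩
    · rw [hΦx v hv, hΦx w hw, hv, hw]
      exact iff_of_false (SimpleGraph.irrefl _) (SimpleGraph.irrefl _)
    · rw [hΦx v hv, hΦ w Z hw, hv, assemble_adj_none, hxY]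
    · rw [hΦx w hw, hΦ v Y hv, hw, assemble_none_adj, hxY, G.adj_comm]
    · rw [hΦ v Y hv, hΦ w Z hw]
      by_cases hYZ : Y = Z
      · subst hYZ
        rw [assemble_adj_some]
        exact (φ Y).map_rel_iff
      · refine iff_of_false (fun h => hYZ (he (assemble_eq_of_adj _ C h))) fun h => hYZ ?_
        exact Subtype.ext (Y.2.eq_of_mem Z.2 (Y.2.closed _ hv _ (Z.2.subset hw) h) hw)
  · intro v
    change (assemble (lab x) C).lab (Φ v) = lab v
    rcases hcases v with hv | ⟨Y, hv⟩
    · rw [hΦx v hv, hv]; rfl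
    · rw [hΦ v Y hv]
      change ((C (e Y)).lab (φ Y ⟨v, hv⟩)).1 = lab v
      rw [hφ]

/-- Patterns of the assembled graph occur in `G[X]` if any finitely many of its parts can be
matched injectively with components of `G[X] - x` of the same profile. -/
theorem profile_assemble_subset [Finite M] (hx : x ∈ X)
    (hσ : ∀ s : Set J, s.Finite → ∃ σ : J → {Y : Set V // IsComp G (X \ {x}) Y}, Set.InjOn σ s ∧
      ∀ j ∈ s, (C j).profile M = profile M G (fun v => (lab v, G.Adj x v)) (σ j).1) :
    (assemble (lab x) C).profile M ⊆ profile M G lab X := by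
  rintro ⟨D, P, l⟩ ⟨f, -, hinj, hadj, hlab⟩
  dsimp only at hinj hadj hlab
  -- The parts met by the pattern; finitely many because `M` is finite.
  let s : Set J := {j | ∃ a v, f a = some ⟨j, v⟩}
  have hs : s.Finite := by
    have h2 : (some '' s) ⊆ Set.range fun a => (f a).map Sigma.fst := by
      rintro _ ⟨j, ⟨a, v, hav⟩, rfl⟩
      exact ⟨a, by dsimp only; rw [hav]; rfl⟩
    exact ((Set.finite_range _).subset h2).of_finite_image (Option.some_injective _).injOn
  obtain ⟨σ, hσinj, hσp⟩ := hσ s hs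
  have key : ∀ j ∈ s, ∃ g : M → V, (∀ a, g a ∈ (σ j).1) ∧
      (∀ a ∈ D, ∀ b ∈ D, ∀ v w, f a = some ⟨j, v⟩ → f b = some ⟨j, w⟩ →
        (g a = g b → a = b) ∧ (P.Adj a b → G.Adj (g a) (g b))) ∧
      ∀ a ∈ D, ∀ v, f a = some ⟨j, v⟩ → lab (g a) = l a ∧ (G.Adj x (g a) ↔ ((C j).lab v).2) := by
    intro j hj
    obtain ⟨a₀, v₀, -⟩ := id hj
    have h1 : ∀ a, ∃ v : (C j).V, ∀ v', f a = some ⟨j, v'⟩ → v = v' := by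
      intro a
      by_cases ha : ∃ v, f a = some ⟨j, v⟩
      · obtain ⟨v, hv⟩ := ha
        refine ⟨v, fun v' hv' => ?_⟩
        rw [hv] at hv'
        exact eq_of_heq (Sigma.mk.inj (Option.some.inj hv')).2
      · exact ⟨v₀, fun v' hv' => absurd ⟨v', hv'⟩ ha⟩
    choose r hr using h1
    -- The trace of the pattern on part j. The values of `r` outside this trace are arbitrary. The
    -- second label component remembers adjacency to x, so the copies found in the components can be
    -- glued together at x.
    have hp : (({a | a ∈ D ∧ ∃ v, f a = some ⟨j, v⟩}, P, fun a => (C j).lab (r a)) :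
        Pattern M (Λ × Prop)) ∈ (C j).profile M := by
      refine ⟨r, fun _ => trivial, ?_, ?_, fun a _ => rfl⟩
      · rintro a ⟨ha, v, hv⟩ b ⟨hb, w, hw⟩ hab
        refine hinj ha hb ?_
        rw [hv, hw, ← hr a v hv, ← hr b w hw, hab]
      · rintro a ⟨ha, v, hv⟩ b ⟨hb, w, hw⟩ hab
        have := hadj a ha b hb hab
        rw [hv, hw, assemble_adj_some] at this
        rwa [hr a v hv, hr b w hw]
    rw [hσp j hj] at hp
    obtain ⟨g, hg, hginj, hgadj, hglab⟩ := hp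
    refine ⟨g, hg, ?_, ?_⟩
    · intro a ha b hb v w hv hw
      exact ⟨fun h => hginj ⟨ha, v, hv⟩ ⟨hb, w, hw⟩ h, hgadj a ⟨ha, v, hv⟩ b ⟨hb, w, hw⟩⟩
    · intro a ha v hv
      have h1 : (lab (g a), G.Adj x (g a)) = (C j).lab (r a) := hglab a ⟨ha, v, hv⟩
      have h2 := hlab a ha
      rw [hv] at h2
      have h3 : ((C j).lab v).1 = l a := h2
      rw [hr a v hv] at h1
      rw [← h3, ← h1]
      exact ⟨rfl, Iff.rfl⟩
  have : Nonempty V := ⟨x⟩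
  choose! g hgm hg2 hg1 using key
  have hfs : ∀ a, f a = none ∨ ∃ j v, f a = some ⟨j, v⟩ ∧ j ∈ s := by
    intro a
    rcases hfa : f a with _ | ⟨j, v⟩
    · exact Or.inl rfl
    · exact Or.inr ⟨j, v, rfl, a, v, hfa⟩
  let F : M → V := fun a => match f a with
    | none => x
    | some w => g w.1 a
  have hF0 : ∀ a, f a = none → F a = x := fun a ha => by simp only [F, ha]
  have hF1 : ∀ a j v, f a = some ⟨j, v⟩ → F a = g j a := fun a j v ha => by simp only [F, ha]
  refine ⟨F, ?_, ?_, ?_, ?_⟩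
  · intro a
    rcases hfs a with ha | ⟨j, v, ha, hj⟩
    · rw [hF0 a ha]; exact hx
    · rw [hF1 a j v ha]; exact ((σ j).2.subset (hgm j hj a)).1
  · intro a ha b hb hab
    rcases hfs a with ha' | ⟨j, v, ha', hj⟩ <;> rcases hfs b with hb' | ⟨i, w, hb', hi⟩
    · exact hinj ha hb (ha'.trans hb'.symm)
    · rw [hF0 a ha', hF1 b i w hb'] at hab
      exact absurd hab.symm ((σ i).2.subset (hgm i hi b)).2
    · rw [hF0 b hb', hF1 a j v ha'] at hab
      exact absurd hab ((σ j).2.subset (hgm j hj a)).2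
    · rw [hF1 a j v ha', hF1 b i w hb'] at hab
      have hji : j = i := hσinj hj hi
        (Subtype.ext ((σ j).2.eq_of_mem (σ i).2 (hgm j hj a) (hab ▸ hgm i hi b)))
      subst hji
      exact (hg2 j hj a ha b hb v w ha' hb').1 hab
  · intro a ha b hb hab
    have hab' := hadj a ha b hb hab
    rcases hfs a with ha' | ⟨j, v, ha', hj⟩ <;> rcases hfs b with hb' | ⟨i, w, hb', hi⟩
    · rw [ha', hb'] at hab'
      exact absurd hab' (SimpleGraph.irrefl _)
    · rw [ha', hb', assemble_adj_none] at hab'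
      rw [hF0 a ha', hF1 b i w hb']
      exact (hg1 i hi b hb w hb').2.2 hab'
    · rw [ha', hb', assemble_none_adj] at hab'
      rw [hF0 b hb', hF1 a j v ha']
      exact ((hg1 j hj a ha v ha').2.2 hab').symm
    · rw [ha', hb'] at hab'
      obtain rfl := assemble_eq_of_adj _ C hab'
      rw [hF1 a j v ha', hF1 b j w hb']
      exact (hg2 j hj a ha b hb v w ha' hb').2 hab
  · intro a ha
    change lab (F a) = l a
    rcases hfs a with ha' | ⟨j, v, ha', hj⟩
    · rw [hF0 a ha', ← hlab a ha, ha']; rfl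
    · rw [hF1 a j v ha']
      exact (hg1 j hj a ha v ha').1

end Assemble

end Labelled

/-! ### Small universal families by induction on the rank -/

section Families

/-- If the sets of rank less than `β` have small families for all label sets, so do the sets from
which the deletion of one vertex leaves such sets. -/
theorem HasFamily.step {κ μ : Cardinal.{u}} (hκ : ℵ₀ ≤ κ) (hμ : ℵ₀ ≤ μ) (hμκ : μ ≤ κ)
    {M Λ : Type} [Finite M] [Nonempty M] [Finite Λ] {β : Ordinal.{u}}
    (h : HasFamily κ μ M (Λ × Prop) fun _ G X => RankLT G β X) :
    HasFamily κ μ M Λ fun _ G X =>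
      ∃ x ∈ X, ∀ Y ⊆ X \ {x}, (G.induce Y).Connected → RankLT G β Y := by
  classical
  obtain ⟨T, U, hT, hU, hcap⟩ := h
  let Q : Type := Set (Pattern M (Λ × Prop))
  let K : Type u := κ.out
  -- The data of an assembled graph: the label of x, the list of graphs for the exceptional
  -- components, and the set of profiles that occur infinitely often. There are at most μ such data,
  -- as lists are finite and profiles finite in number.
  let Dt : Type u := Λ × (Σ n : ℕ, (Fin n → T)) × Set Q
  let J : Dt → Type u := fun d => ULift.{u} (Fin d.2.1.1) ⊕ ({t : T // (U t).profile M ∈ d.2.2} × K)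
  let C : ∀ d, J d → LGraph.{u} (Λ × Prop) := fun d =>
    Sum.elim (fun i => U (d.2.1.2 i.down)) (fun q => U q.1)
  have hJ : ∀ d, #(J d) ≤ κ := by
    intro d
    rw [Cardinal.mk_sum, Cardinal.lift_id, Cardinal.lift_id]
    refine Cardinal.add_le_of_le hκ ((Cardinal.lt_aleph0_of_finite _).le.trans hκ) ?_
    rw [Cardinal.mk_prod, Cardinal.lift_id, Cardinal.lift_id]
    exact Cardinal.mul_le_of_le hκ ((Cardinal.mk_subtype_le _).trans (hT.trans hμκ))
      (Cardinal.mk_out κ).le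
  have hC : ∀ d j, (C d j).Good κ := by
    rintro d (i | q)
    · exact hU _
    · exact hU _
  have hDt : #Dt ≤ μ := by
    have h1 : #(Σ n : ℕ, (Fin n → T)) ≤ μ :=
      (Cardinal.mk_congr List.equivSigmaTuple.symm).le.trans
        ((Cardinal.mk_list_le_max T).trans (max_le hμ hT))
    have h2 : #(Set Q) ≤ ℵ₀ := Cardinal.mk_le_aleph0
    have h3 : #Λ ≤ ℵ₀ := Cardinal.mk_le_aleph0
    simp only [Dt, Cardinal.mk_prod]
    have h2' := (Cardinal.lift_le.{u}.2 h2)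
    have h3' := (Cardinal.lift_le.{u}.2 h3)
    rw [Cardinal.lift_aleph0] at h2' h3'
    have h4 : Cardinal.lift.{0} #(Σ n : ℕ, (Fin n → T)) * Cardinal.lift.{u} #(Set Q) ≤ μ := by
      rw [Cardinal.lift_uzero]
      exact Cardinal.mul_le_of_le hμ h1 (h2'.trans hμ)
    rw [Cardinal.lift_uzero]
    exact Cardinal.mul_le_of_le hμ (h3'.trans hμ) h4
  -- Arbitrary data may assemble to a disconnected graph, so only good ones are kept.
  refine ⟨{d : Dt // (assemble d.1 (C d)).Good κ}, fun d => assemble d.1.1 (C d.1),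
    (Cardinal.mk_subtype_le _).trans hDt, fun d => d.2, ?_⟩
  rintro V G lab X hX hXκ ⟨x, hx, hY⟩
  let I := {Y : Set V // IsComp G (X \ {x}) Y}
  let lab' : V → Λ × Prop := fun v => (lab v, G.Adj x v)
  have hIX : #I ≤ #X := by
    refine Cardinal.mk_le_of_injective (f := fun Y : I => (⟨Y.2.nonempty.some,
      (Y.2.subset Y.2.nonempty.some_mem).1⟩ : X)) ?_
    rintro ⟨Y, hY⟩ ⟨Y', hY'⟩ h
    refine Subtype.ext (hY.eq_of_mem hY' hY.nonempty.some_mem ?_)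
    have h : hY.nonempty.some = hY'.nonempty.some := congrArg Subtype.val h
    rw [h]
    exact hY'.nonempty.some_mem
  have hcapI : ∀ i : I, ∃ t, Captures M (U t) G lab' i.1 := by
    intro i
    have hiX : i.1 ⊆ X := fun v hv => (i.2.subset hv).1
    exact hcap V G lab' i.1 i.2.conn ((Cardinal.mk_le_mk_of_subset hiX).trans hXκ)
      (hY i.1 i.2.subset i.2.conn)
  choose t ht using hcapI
  let q : I → Q := fun i => profile M G lab' i.1
  -- The exceptional components, whose profile occurs only finitely often. They are finite in number
  -- because there are finitely many profiles.
  let I0 : Set I := {i | {i' | q i' = q i}.Finite}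
  have hI0 : I0.Finite := by
    refine Set.Finite.subset (Set.Finite.biUnion
      (s := {c : Q | {i' | q i' = c}.Finite}) (t := fun c => {i' | q i' = c}) (Set.toFinite _)
      fun c hc => hc) ?_
    intro i hi
    exact Set.mem_biUnion (x := q i) hi rfl
  obtain ⟨n, ⟨ε⟩⟩ := hI0.exists_equiv_fin
  let B : Set Q := {c | {i' | q i' = c}.Infinite}
  let d : Dt := (lab x, ⟨n, fun k => t (ε.symm k)⟩, B)
  have hIK : #I ≤ #K := by
    rw [Cardinal.mk_out]; exact hIX.trans hXκ
  obtain ⟨kf⟩ := hIK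
  have hBt : ∀ i : I, i ∉ I0 → (U (t i)).profile M ∈ B := by
    intro i hi
    rw [(ht i).2]
    exact hi
  let e : I → J d := fun i =>
    if h : i ∈ I0 then Sum.inl ⟨ε ⟨i, h⟩⟩ else Sum.inr (⟨t i, hBt i h⟩, kf i)
  have he1 : ∀ (i : I) (h : i ∈ I0), e i = Sum.inl ⟨ε ⟨i, h⟩⟩ := fun i h => dif_pos h
  have he2 : ∀ (i : I) (h : i ∉ I0), e i = Sum.inr (⟨t i, hBt i h⟩, kf i) := fun i h => dif_neg h
  have he : Function.Injective e := by
    intro i i' hii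
    by_cases h : i ∈ I0 <;> by_cases h' : i' ∈ I0
    · rw [he1 i h, he1 i' h'] at hii
      exact congrArg Subtype.val (ε.injective (ULift.up.inj (Sum.inl.inj hii)))
    · rw [he1 i h, he2 i' h'] at hii; cases hii
    · rw [he2 i h, he1 i' h'] at hii; cases hii
    · rw [he2 i h, he2 i' h'] at hii
      exact kf.injective (congrArg Prod.snd (Sum.inr.inj hii))
  have hCe : ∀ i, C d (e i) = U (t i) := by
    intro i
    by_cases h : i ∈ I0
    · rw [he1 i h]
      simp [C, d]
    · rw [he2 i h]
      simp [C]
  have hσ : ∀ s : Set (J d), s.Finite → ∃ σ : J d → I, Set.InjOn σ s ∧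
      ∀ j ∈ s, (C d j).profile M = profile M G lab' (σ j).1 := by
    intro s hs
    obtain ⟨N, ⟨δ⟩⟩ := hs.exists_equiv_fin
    -- An exceptional part returns to its own component. Any other part goes to the component
    -- numbered m among those with its profile, where m is its number under `δ`. Parts with equal
    -- profiles thus receive different components, and none of these lies in `I0`.
    let ν : ∀ c : B, ℕ ↪ {i' | q i' = c.1} := fun c => c.2.natEmbedding
    have key : ∀ j : J d, ∃ i : I, (C d j).profile M = q i ∧
        ((∃ k, j = Sum.inl k ∧ i = ε.symm k.down) ∨
          (∃ c k m, j = Sum.inr (c, k) ∧ i = ν ⟨_, c.2⟩ m ∧ i ∉ I0 ∧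
            ∀ h : j ∈ s, (δ ⟨j, h⟩ : ℕ) = m)) := by
      rintro (k | ⟨c, k⟩)
      · exact ⟨ε.symm k.down, (ht _).2, Or.inl ⟨k, rfl, rfl⟩⟩
      · obtain ⟨m, hm⟩ : ∃ m : ℕ, ∀ h : (Sum.inr (c, k) : J d) ∈ s,
            (δ ⟨Sum.inr (c, k), h⟩ : ℕ) = m := by
          by_cases h : (Sum.inr (c, k) : J d) ∈ s
          · exact ⟨δ ⟨Sum.inr (c, k), h⟩, fun _ => rfl⟩
          · exact ⟨0, fun h' => absurd h' h⟩
        have hq : q (ν ⟨_, c.2⟩ m) = (U c.1).profile M := (ν ⟨_, c.2⟩ m).2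
        refine ⟨ν ⟨_, c.2⟩ m, hq.symm, Or.inr ⟨c, k, m, rfl, rfl, ?_, hm⟩⟩
        intro hfin
        have hfin : {i' | q i' = q (ν ⟨_, c.2⟩ m)}.Finite := hfin
        rw [hq] at hfin
        exact c.2 hfin
    choose σ hσq hσ using key
    refine ⟨σ, ?_, fun j _ => hσq j⟩
    intro j hj j' hj' hjj
    rcases hσ j with ⟨k, hk, hik⟩ | ⟨c, k, m, hk, hik, hi0, hm⟩ <;>
      rcases hσ j' with ⟨k', hk', hik'⟩ | ⟨c', k', m', hk', hik', hi0', hm'⟩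
    · rw [hik, hik'] at hjj
      have := ε.symm.injective (Subtype.ext hjj)
      rw [hk, hk', ULift.ext _ _ this]
    · exact absurd (hjj ▸ hik ▸ (ε.symm k.down).2) hi0'
    · exact absurd (hjj.symm ▸ hik' ▸ (ε.symm k'.down).2) hi0
    · have hcc : (U c.1).profile M = (U c'.1).profile M := by
        have h1 : q (σ j) = (U c.1).profile M := by rw [hik]; exact (ν ⟨_, c.2⟩ m).2
        have h2 : q (σ j') = (U c'.1).profile M := by rw [hik']; exact (ν ⟨_, c'.2⟩ m').2
        rw [← h1, ← h2, hjj]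
      have hνν : (⟨_, c.2⟩ : B) = ⟨_, c'.2⟩ := Subtype.ext hcc
      rw [hik, hik', hνν] at hjj
      have hmm := (ν _).injective (Subtype.ext hjj)
      have := δ.injective (Fin.ext ((hm hj).trans (hmm.trans (hm' hj').symm)))
      exact congrArg Subtype.val this
  have hgood : (assemble d.1 (C d)).Good κ := by
    refine ⟨assemble_connected _ _ (fun j => (hC d j).conn) fun j => ?_,
      assemble_rayless _ _ fun j => (hC d j).rayless,
      assemble_card _ _ hκ (hJ d) fun j => (hC d j).card⟩
    -- Each part must be joined to the new vertex. The matched component contains a neighbour of x,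
    -- and a one-vertex pattern transfers this fact to the part; this is where `M` must be nonempty.
    obtain ⟨σ, -, hσp⟩ := hσ {j} (Set.finite_singleton j)
    obtain ⟨y, hy, hxy⟩ := (σ j).2.exists_adj hX hx
    obtain ⟨m⟩ := ‹Nonempty M›
    have hp : (({m}, ⊥, fun _ => lab' y) : Pattern M (Λ × Prop)) ∈ (C d j).profile M := by
      rw [hσp j rfl]
      exact ⟨fun _ => y, fun _ => hy, Set.injOn_singleton _ _, fun a _ b _ hab => hab.elim,
        fun _ _ => rfl⟩
    obtain ⟨f, -, -, -, hf⟩ := hp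
    refine ⟨f m, ?_⟩
    rw [hf m rfl]
    exact hxy
  obtain ⟨φ, hφ⟩ := exists_embedding_assemble (G := G) (lab := lab) (X := X) (x := x) (C d) e he
    fun i => by rw [hCe i]; exact (ht i).1
  exact ⟨⟨d, hgood⟩, captures_of_subset φ hφ (profile_assemble_subset (C d) hx hσ)⟩

/-- The `κ`-rayless graphs of rank less than `α` have a universal family of size at most
`max ℵ₀ |α|` that respects finite profiles. -/
theorem hasFamily_rankLT {κ μ : Cardinal.{u}} (hκ : ℵ₀ ≤ κ) (hμ : ℵ₀ ≤ μ) (hμκ : μ ≤ κ)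
    {M : Type} [Finite M] [Nonempty M] (α : Ordinal.{u}) : α.card ≤ μ → ∀ (Λ : Type) [Finite Λ],
      HasFamily κ μ M Λ fun _ G X => RankLT G α X := by
  -- The label set stays universally quantified, since the step from β to α enlarges Λ to Λ × Prop.
  induction α using WellFoundedLT.induction with
  | ind α ih =>
  intro hα Λ _
  have h : ∀ b : α.ToType, HasFamily κ μ M Λ fun _ G X =>
      ∃ x ∈ X, ∀ Y ⊆ X \ {x}, (G.induce Y).Connected → RankLT G (b.toOrd : Ordinal.{u}) Y :=
    fun b => HasFamily.step hκ hμ hμκ (ih _ b.toOrd.2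
      ((Ordinal.card_le_card (le_of_lt b.toOrd.2)).trans hα) _)
  choose T U hT hU hcap using h
  refine ⟨Σ b, T b, fun p => U p.1 p.2, ?_, fun p => hU _ _, ?_⟩
  · rw [Cardinal.mk_sigma]
    refine (Cardinal.sum_le_mk_mul_iSup _).trans ?_
    rw [Cardinal.mk_toType]
    exact Cardinal.mul_le_of_le hμ hα (ciSup_le' hT)
  · intro V G lab X hX hXκ hr
    obtain ⟨β, hβ, hx⟩ := rankLT_iff.1 hr
    obtain ⟨t, ht⟩ := hcap (Ordinal.ToType.mk ⟨β, hβ⟩) V G lab X hX hXκ (by simpa using hx)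
    exact ⟨⟨_, t⟩, ht⟩

end Families

/-! ### The tree of paths and the diagonal argument -/

section PathTree

variable {V : Type u}

/-- The lists that code the paths of `H`, each entry being repeated `m` times (the last one
possibly fewer times). -/
structure IsNode (H : SimpleGraph V) (m : ℕ) (w : List V) : Prop where
  const : ∀ p a b, ¬ m ∣ p + 1 → w[p]? = some a → w[p + 1]? = some b → a = b
  inj : ∀ i j a, w[m * i]? = some a → w[m * j]? = some a → i = j
  adj : ∀ i a b, w[m * i]? = some a → w[m * (i + 1)]? = some b → H.Adj a b

/-- The tree of the lists that code paths of `H`, ordered by extension. -/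
def pathTree (H : SimpleGraph V) (m : ℕ) : SimpleGraph {w : List V // IsNode H m w} :=
  SimpleGraph.fromRel fun a b => ∃ v, b.1 = a.1 ++ [v]

variable {H : SimpleGraph V} {m : ℕ}

theorem getElem?_append_of_eq_some {l t : List V} {i : ℕ} {a : V} (h : l[i]? = some a) :
    (l ++ t)[i]? = some a := by
  rw [List.getElem?_append_left (List.getElem?_eq_some_iff.1 h).1, h]

theorem isNode_nil : IsNode H m [] := ⟨by simp, by simp, by simp⟩

theorem IsNode.prefix {w w' : List V} (h : IsNode H m w) (hw : w' <+: w) : IsNode H m w' := by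
  have key : ∀ (p : ℕ) (a : V), w'[p]? = some a → w[p]? = some a := by
    intro p a hp
    obtain ⟨t, rfl⟩ := hw
    exact getElem?_append_of_eq_some hp
  exact ⟨fun p a b hp ha hb => h.const p a b hp (key _ _ ha) (key _ _ hb),
    fun i j a ha hb => h.inj i j a (key _ _ ha) (key _ _ hb),
    fun i a b ha hb => h.adj i a b (key _ _ ha) (key _ _ hb)⟩

theorem pathTree_adj {a b : {w : List V // IsNode H m w}} :
    (pathTree H m).Adj a b ↔ (∃ v, b.1 = a.1 ++ [v]) ∨ ∃ v, a.1 = b.1 ++ [v] := by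
  rw [pathTree, SimpleGraph.fromRel_adj]
  refine and_iff_right_of_imp ?_
  rintro (⟨v, h⟩ | ⟨v, h⟩) rfl <;> simp at h

theorem pathTree_connected : (pathTree H m).Connected := by
  rw [SimpleGraph.connected_iff_exists_forall_reachable]
  refine ⟨⟨[], isNode_nil⟩, ?_⟩
  rintro ⟨w, hw⟩
  induction w using List.reverseRecOn with
  | nil => exact SimpleGraph.Reachable.refl _
  | append_singleton w v ih =>
    refine (ih (hw.prefix (List.prefix_append _ _))).trans (SimpleGraph.Adj.reachable ?_)
    exact pathTree_adj.2 (Or.inl ⟨v, rfl⟩)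

theorem pathTree_card {κ : Cardinal.{u}} (hκ : ℵ₀ ≤ κ) (hV : #V ≤ κ) :
    #{w : List V // IsNode H m w} ≤ κ :=
  (Cardinal.mk_subtype_le _).trans ((Cardinal.mk_list_le_max V).trans (max_le hκ hV))

/-- Parents are unique, so a ray that has once moved upwards continues upwards, and it cannot
descend forever. Its lists then converge to an infinite sequence whose entries at the multiples of m
form a ray in `H`. -/
theorem pathTree_rayless (hH : IsRayless H) (hm : 0 < m) : IsRayless (pathTree H m) := by
  rintro ⟨r, hr, hadj⟩
  have hup : ∀ n, (∃ v, (r (n + 1)).1 = (r n).1 ++ [v]) →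
      ∃ v, (r (n + 2)).1 = (r (n + 1)).1 ++ [v] := by
    rintro n ⟨v, hv⟩
    rcases pathTree_adj.1 (hadj (n + 1)) with h | ⟨v', hv'⟩
    · exact h
    · rw [hv] at hv'
      have := hr (Subtype.ext (List.append_inj_left' hv' rfl))
      omega
  have hex : ∃ N, ∃ v, (r (N + 1)).1 = (r N).1 ++ [v] := by
    by_contra! hno
    have hdec : ∀ n, (r n).1.length + n ≤ (r 0).1.length := by
      intro n
      induction n with
      | zero => simp
      | succ n ih =>
        rcases pathTree_adj.1 (hadj n) with ⟨v, hv⟩ | ⟨v, hv⟩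
        · exact absurd hv (hno n v)
        · rw [hv, List.length_append, List.length_singleton] at ih
          omega
    have := hdec ((r 0).1.length + 1)
    omega
  obtain ⟨N, hN⟩ := hex
  have hall : ∀ k, ∃ v, (r (N + k + 1)).1 = (r (N + k)).1 ++ [v] := by
    intro k
    induction k with
    | zero => exact hN
    | succ k ih => exact hup _ ih
  have hlen : ∀ k, k ≤ (r (N + k)).1.length := by
    intro k
    induction k with
    | zero => simp
    | succ k ih =>
      obtain ⟨v, hv⟩ := hall k
      rw [← add_assoc, hv, List.length_append, List.length_singleton]
      omega
  have hpre : ∀ k l, k ≤ l → (r (N + k)).1 <+: (r (N + l)).1 := by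
    intro k l hkl
    induction hkl with
    | refl => exact List.prefix_refl _
    | @step l _ ih =>
      obtain ⟨v, hv⟩ := hall l
      refine ih.trans ?_
      rw [Nat.succ_eq_add_one, ← add_assoc, hv]
      exact List.prefix_append _ _
  have hs : ∀ i, ∃ a, (r (N + (m * i + 1))).1[m * i]? = some a := fun i =>
    ⟨_, List.getElem?_eq_getElem (hlen _)⟩
  choose s hs using hs
  have hs' : ∀ i k, m * i + 1 ≤ k → (r (N + k)).1[m * i]? = some (s i) := by
    intro i k hk
    obtain ⟨t, ht⟩ := hpre _ _ hk
    rw [← ht]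
    exact getElem?_append_of_eq_some (hs i)
  refine hH ⟨s, fun i j hij => ?_, fun i => ?_⟩
  · refine (r (N + (m * i + m * j + 1))).2.inj i j (s i) (hs' _ _ (by omega)) ?_
    rw [hij]
    exact hs' _ _ (by omega)
  · exact (r (N + (m * (i + 1) + 1))).2.adj i _ _ (hs' _ _ (by rw [mul_add]; omega))
      (hs' _ _ le_rfl)

/-- The tree of paths of a rayless graph does not immerse into that graph. -/
theorem pathTree_free (hH : IsRayless H) (hm : 0 < m) : (pathTree H m).Free H := by
  classical
  rintro ⟨f, hf⟩
  -- The default value at non-nodes only makes the recursion total; all lists used turn out to be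
  -- nodes.
  let f' : List V → V := fun w => if h : IsNode H m w then f ⟨w, h⟩ else f ⟨[], isNode_nil⟩
  have hf' : ∀ w (h : IsNode H m w), f' w = f ⟨w, h⟩ := fun w h => dif_pos h
  -- With r n the image of the node z n, the list p n repeats each of r 0, …, r (n - 1) exactly m
  -- times, and z n consists of its first n entries. Thus z n depends only on earlier values of r.
  -- The z n form an ascending path in the tree, so their images form a ray in `H`.
  let p : ℕ → List V := fun n =>
    Nat.rec [] (fun n w => w ++ List.replicate m (f' (w.take n))) n
  have hps : ∀ n, p (n + 1) = p n ++ List.replicate m (f' ((p n).take n)) := fun _ => rfl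
  let z : ℕ → List V := fun n => (p n).take n
  let r : ℕ → V := fun n => f' (z n)
  have hplen : ∀ n, (p n).length = m * n := by
    intro n
    induction n with
    | zero => rfl
    | succ n ih => rw [hps, List.length_append, ih, List.length_replicate, mul_add, mul_one]
  have hp : ∀ n k, k < m * n → (p n)[k]? = some (r (k / m)) := by
    intro n
    induction n with
    | zero => intro k hk; simp at hk
    | succ n ih =>
      intro k hk
      rw [hps]
      by_cases h : k < m * n
      · exact getElem?_append_of_eq_some (ih k h)
      · have hkm : k / m = n := by
          rw [Nat.div_eq_iff hm]
          rw [mul_add, mul_one] at hk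
          push Not at h
          rw [mul_comm n m]
          omega
        rw [List.getElem?_append_right (by rw [hplen]; omega), hplen,
          List.getElem?_replicate_of_lt (by rw [mul_add] at hk; omega), hkm]
  have hp' : ∀ n k a, (p n)[k]? = some a → k < m * n ∧ a = r (k / m) := by
    intro n k a h
    have hk : k < m * n := by
      rw [← hplen n]
      exact (List.getElem?_eq_some_iff.1 h).1
    refine ⟨hk, ?_⟩
    rw [hp n k hk] at h
    exact (Option.some.inj h).symm
  have hzlen : ∀ n, (z n).length = n := by
    intro n
    rw [List.length_take, hplen]
    exact min_eq_left (Nat.le_mul_of_pos_left n hm)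
  have hz : ∀ n k, k < n → (z n)[k]? = some (r (k / m)) := by
    intro n k hk
    rw [List.getElem?_take_of_lt hk]
    exact hp n k (hk.trans_le (Nat.le_mul_of_pos_left n hm))
  have hzs : ∀ n, z (n + 1) = z n ++ [r (n / m)] := by
    intro n
    refine List.ext_getElem? fun k => ?_
    rcases lt_trichotomy k n with h | rfl | h
    · rw [hz _ _ (h.trans (Nat.lt_succ_self n)), getElem?_append_of_eq_some (hz n k h)]
    · rw [hz _ _ (Nat.lt_succ_self k), List.getElem?_append_right (hzlen k).le, hzlen]
      simp
    · rw [List.getElem?_eq_none (by rw [hzlen]; omega), List.getElem?_eq_none]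
      rw [List.length_append, hzlen, List.length_singleton]
      omega
  have hdiv : ∀ i n, m * i < m * n → i < n := fun i n h => lt_of_mul_lt_mul_left h (Nat.zero_le m)
  have hrinj : ∀ i j, IsNode H m (z i) → IsNode H m (z j) → r i = r j → i = j := by
    intro i j hi hj hij
    change f' (z i) = f' (z j) at hij
    rw [hf' _ hi, hf' _ hj] at hij
    have := congrArg (fun w => w.1.length) (hf hij)
    simpa only [hzlen] using this
  have hradj : ∀ i, IsNode H m (z i) → IsNode H m (z (i + 1)) → H.Adj (r i) (r (i + 1)) := by
    intro i hi hj
    change H.Adj (f' (z i)) (f' (z (i + 1)))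
    rw [hf' _ hi, hf' _ hj]
    exact f.map_rel (pathTree_adj.2 (Or.inl ⟨_, hzs i⟩))
  -- The node conditions for p n concern only the r i with i < n, hence the z i with i < n, which
  -- are prefixes of earlier p i.
  have hnode : ∀ n, IsNode H m (p n) := by
    intro n
    induction n using Nat.strong_induction_on with
    | _ n ih =>
    have ih' : ∀ i < n, IsNode H m (z i) := fun i hi => (ih i hi).prefix (List.take_prefix _ _)
    refine ⟨?_, ?_, ?_⟩
    · intro k a b hk ha hb
      rw [(hp' _ _ _ ha).2, (hp' _ _ _ hb).2, Nat.succ_div_of_not_dvd hk]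
    · intro i j a hi hj
      have h1 := hp' _ _ _ hi
      have h2 := hp' _ _ _ hj
      rw [Nat.mul_div_cancel_left _ hm] at h1 h2
      exact hrinj i j (ih' i (hdiv _ _ h1.1)) (ih' j (hdiv _ _ h2.1)) (h1.2.symm.trans h2.2)
    · intro i a b ha hb
      have h1 := hp' _ _ _ ha
      have h2 := hp' _ _ _ hb
      rw [Nat.mul_div_cancel_left _ hm] at h1 h2
      rw [h1.2, h2.2]
      exact hradj i (ih' i (hdiv _ _ h1.1)) (ih' _ (hdiv _ _ h2.1))
  have hznode : ∀ n, IsNode H m (z n) := fun n => (hnode n).prefix (List.take_prefix _ _)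
  exact hH ⟨r, fun i j hij => hrinj i j (hznode i) (hznode j) hij,
    fun i => hradj i (hznode i) (hznode _)⟩

end PathTree

/-! ### Recognising subdivided stars by coordinates -/

section StarCriterion

/-- A finite connected graph is a subdivided star if its vertices have coordinates as in one: a
branch `br` and a distance `d` from the centre `b`. -/
theorem isStarSubdivision_of_coords {W : Type u} {B : Type*} [Finite W] {K : SimpleGraph W}
    (hK : K.Connected) (b : W) (br : W → B) (d : W → ℕ) (h0 : ∀ w, d w = 0 ↔ w = b)
    (hinj : ∀ w w', w ≠ b → w' ≠ b → br w = br w' → d w = d w' → w = w')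
    (hadj : ∀ w w', K.Adj w w' → (w = b ∧ d w' = 1) ∨ (w' = b ∧ d w = 1) ∨
      (w ≠ b ∧ w' ≠ b ∧ br w = br w' ∧ (d w' = d w + 1 ∨ d w = d w' + 1))) :
    IsStarSubdivision K := by
  classical
  have hu : (K.induce Set.univ).Connected := (SimpleGraph.induceUnivIso K).connected_iff.2 hK
  have hdown : ∀ w, w ≠ b → ∃ w', K.Adj w' w ∧ d w = d w' + 1 ∧ (w' = b ∨ br w' = br w) := by
    intro w hw
    by_contra! hno
    -- If w had no neighbour one step closer to b, the vertices of its branch at distance at least d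
    -- w would be closed under adjacency, and b could not be reached.
    have := subset_of_connected_of_closed (D := {x | x ≠ b ∧ br x = br w ∧ d w ≤ d x}) hu
      (Set.mem_univ w) ⟨hw, rfl, le_rfl⟩ (by
        rintro y ⟨hyb, hyw, hyd⟩ z - hyz
        have hw0 : d w ≠ 0 := fun h => hw ((h0 w).1 h)
        rcases hadj y z hyz with ⟨h, -⟩ | ⟨rfl, h⟩ | ⟨-, hz, hbr, hd⟩
        · exact absurd h hyb
        · have hyw' : y = w := hinj y w hyb hw hyw (by omega)
          subst hyw'
          exact absurd rfl (hno z hyz.symm (by rw [h, (h0 z).2 rfl])).1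
        · refine ⟨hz, hbr ▸ hyw, ?_⟩
          by_contra hlt
          have hyw' : y = w := hinj y w hyb hw hyw (by omega)
          subst hyw'
          exact (hno z hyz.symm (by omega)).2 hbr.symm)
    exact (this (Set.mem_univ b)).1 rfl
  let Up : W → W → Prop := fun w w' =>
    (w = b ∧ d w' = 1) ∨ (w ≠ b ∧ w' ≠ b ∧ br w = br w' ∧ d w' = d w + 1)
  have hUpAdj : ∀ w w', Up w w' → K.Adj w w' := by
    rintro w w' (⟨rfl, h⟩ | ⟨hw, hw', hbr, h⟩)
    · obtain ⟨x, hx, hd, -⟩ := hdown w' fun h' => by rw [(h0 w').2 h'] at h; omega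
      rwa [(h0 x).1 (by omega)] at hx
    · obtain ⟨x, hx, hd, hxb⟩ := hdown w' hw'
      have hw0 : d w ≠ 0 := fun h => hw ((h0 w).1 h)
      have hxb' : x ≠ b := fun h => by rw [(h0 x).2 h] at hd; omega
      rwa [hinj x w hxb' hw ((hxb.resolve_left hxb').trans hbr.symm) (by omega)] at hx
  have hAdj : ∀ w w', K.Adj w w' ↔ Up w w' ∨ Up w' w := by
    intro w w'
    refine ⟨fun h => ?_, fun h => h.elim (hUpAdj _ _) fun h => (hUpAdj _ _ h).symm⟩
    rcases hadj w w' h with h | h | ⟨h1, h2, h3, h4 | h4⟩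
    · exact Or.inl (Or.inl h)
    · exact Or.inr (Or.inl h)
    · exact Or.inl (Or.inr ⟨h1, h2, h3, h4⟩)
    · exact Or.inr (Or.inr ⟨h2, h1, h3.symm, h4⟩)
  let I : Set B := br '' {w | w ≠ b}
  obtain ⟨n, ⟨e⟩⟩ := (Set.toFinite I).exists_equiv_fin
  have htop : ∀ i : Fin n, ∃ w, (w ≠ b ∧ br w = e.symm i) ∧
      ∀ w', (w' ≠ b ∧ br w' = e.symm i) → d w' ≤ d w := by
    intro i
    obtain ⟨w, hw, hwi⟩ := (e.symm i).2
    obtain ⟨t, ht, htm⟩ := Set.exists_max_image {w' | w' ≠ b ∧ br w' = e.symm i} d (Set.toFinite _)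
      ⟨w, hw, hwi⟩
    exact ⟨t, ht, htm⟩
  choose top htop htopm using htop
  let ℓ : Fin n → ℕ := fun i => d (top i) - 1
  have hpos : ∀ w, w ≠ b → 1 ≤ d w := fun w hw => Nat.one_le_iff_ne_zero.2 fun h => hw ((h0 w).1 h)
  -- Descending from the farthest vertex of a branch shows that every smaller positive distance
  -- occurs on it.
  have hvtx : ∀ (i : Fin n) (k : ℕ), k ≤ ℓ i →
      ∃ w, w ≠ b ∧ br w = e.symm i ∧ d w + k = ℓ i + 1 := by
    intro i k
    induction k with
    | zero =>
      intro _
      have := hpos _ (htop i).1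
      exact ⟨top i, (htop i).1, (htop i).2, by simp only [ℓ]; omega⟩
    | succ k ih =>
      intro hk
      obtain ⟨w, hw, hwi, hd⟩ := ih (by omega)
      obtain ⟨w', -, hd', hbr⟩ := hdown w hw
      have hw' : w' ≠ b := fun h => by rw [(h0 w').2 h] at hd'; omega
      exact ⟨w', hw', (hbr.resolve_left hw').trans hwi, by omega⟩
  have hvtx' : ∀ (i : Fin n) (j : Fin (ℓ i + 1)),
      ∃ w, w ≠ b ∧ br w = e.symm i ∧ d w = j + 1 := by
    intro i j
    obtain ⟨w, h1, h2, h3⟩ := hvtx i (ℓ i - j) (Nat.sub_le _ _)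
    exact ⟨w, h1, h2, by omega⟩
  choose v hvb hvi hvd using hvtx'
  let φ : Option (Σ i : Fin n, Fin (ℓ i + 1)) → W := fun x => x.elim b fun a => v a.1 a.2
  have hφinj : Function.Injective φ := by
    rintro (_ | ⟨i, j⟩) (_ | ⟨i', j'⟩) h
    · rfl
    · exact absurd (Eq.symm h) (hvb _ _)
    · exact absurd h (hvb _ _)
    · have h : v i j = v i' j' := h
      have hi : i = i' := e.symm.injective (Subtype.ext (by rw [← hvi i j, ← hvi i' j', h]))
      subst hi
      have h1 := hvd i j
      have h2 := hvd i j'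
      have hj : j = j' := Fin.ext (by rw [h] at h1; omega)
      rw [hj]
  have hφsurj : Function.Surjective φ := by
    intro w
    by_cases hw : w = b
    · exact ⟨none, hw.symm⟩
    · have hi : ((e.symm (e ⟨br w, w, hw, rfl⟩) : I) : B) = br w := by rw [e.symm_apply_apply]
      have h1 := hpos w hw
      have h2 := htopm (e ⟨br w, w, hw, rfl⟩) w ⟨hw, hi.symm⟩
      refine ⟨some ⟨e ⟨br w, w, hw, rfl⟩, ⟨d w - 1, ?_⟩⟩, ?_⟩
      · simp only [ℓ]; omega
      · refine hinj _ _ (hvb _ _) hw ((hvi _ _).trans hi) ?_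
        exact (hvd _ _).trans (Nat.sub_add_cancel h1)
  let R : Option (Σ i : Fin n, Fin (ℓ i + 1)) → Option (Σ i : Fin n, Fin (ℓ i + 1)) → Prop :=
    fun x y => (∃ i, x = none ∧ y = some ⟨i, 0⟩) ∨
      ∃ i, ∃ j : Fin (ℓ i), x = some ⟨i, j.castSucc⟩ ∧ y = some ⟨i, j.succ⟩
  have hR : ∀ x y, Up (φ x) (φ y) ↔ R x y := by
    intro x y
    constructor
    · rcases x with _ | ⟨i, j⟩ <;> rcases y with _ | ⟨i', j'⟩
      · rintro (⟨-, h⟩ | ⟨h, -⟩)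
        · have : d b = 1 := h
          rw [(h0 b).2 rfl] at this
          omega
        · exact absurd rfl h
      · rintro (⟨-, h⟩ | ⟨h, -⟩)
        · have h : d (v i' j') = 1 := h
          rw [hvd] at h
          exact Or.inl ⟨i', rfl, by rw [show j' = 0 from Fin.ext (by simpa using h)]⟩
        · exact absurd rfl h
      · rintro (⟨h, -⟩ | ⟨-, h, -⟩)
        · exact absurd h (hvb _ _)
        · exact absurd rfl h
      · rintro (⟨h, -⟩ | ⟨-, -, h, h'⟩)
        · exact absurd h (hvb _ _)
        · have h : br (v i j) = br (v i' j') := h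
          have h' : d (v i' j') = d (v i j) + 1 := h'
          rw [hvi, hvi] at h
          obtain rfl := e.symm.injective (Subtype.ext h)
          rw [hvd, hvd] at h'
          have := j'.2
          have hj : j' = Fin.succ ⟨j, by omega⟩ := Fin.ext (by simp only [Fin.val_succ]; omega)
          exact Or.inr ⟨i, ⟨j, by omega⟩, rfl, by rw [← hj]⟩
    · rintro (⟨i, rfl, rfl⟩ | ⟨i, j, rfl, rfl⟩)
      · exact Or.inl ⟨rfl, (hvd i 0).trans rfl⟩
      · refine Or.inr ⟨hvb _ _, hvb _ _, (hvi _ _).trans (hvi _ _).symm, ?_⟩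
        exact (hvd _ _).trans (congrArg (· + 1) (hvd i j.castSucc)).symm
  refine ⟨n, ℓ, ⟨RelIso.symm ⟨Equiv.ofBijective φ ⟨hφinj, hφsurj⟩, fun {x y} => ?_⟩⟩⟩
  rw [subdividedStar, SimpleGraph.fromRel_adj]
  change K.Adj (φ x) (φ y) ↔ x ≠ y ∧ (R x y ∨ R y x)
  rw [← hR, ← hR, ← hAdj]
  exact ⟨fun h => ⟨fun hxy => h.ne (congrArg φ hxy), h⟩, fun h => h.2⟩

end StarCriterion

/-! ### Small connected subgraphs of the path tree -/

section PathTreeSubgraphs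

variable {V : Type u} {H : SimpleGraph V} {m : ℕ}

/-- The vertices `w` of the path tree that are comparable with `B` and such that, apart from `B`
itself, no possible branching vertex lies on the path between `w` and `B`. -/
def Near (m : ℕ) (B w : List V) : Prop :=
  (w <+: B ∧ ∀ p, w.length ≤ p → p < B.length → ¬ m ∣ p) ∨
    (B <+: w ∧ ∀ p, B.length < p → p ≤ w.length → ¬ m ∣ p)

theorem near_refl (B : List V) : Near m B B :=
  Or.inl ⟨List.prefix_refl _, fun _ h h' => absurd h h'.not_ge⟩

theorem Near.comparable {B w : List V} (h : Near m B w) : w <+: B ∨ B <+: w :=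
  h.imp And.left And.left

theorem eq_of_comparable {B w : List V} (h : w <+: B ∨ B <+: w) (hl : w.length = B.length) :
    w = B :=
  h.elim (fun h => h.eq_of_length hl) fun h => (h.eq_of_length hl.symm).symm

/-- Comparability could fail only by leaving the path to B at a proper prefix w. The length of w is
not divisible by m, so w and B both continue by repeating the last entry of w; the empty list is
ruled out since m divides 0. -/
theorem Near.comparable_of_adj {B w w' : List V} (h : Near m B w) (hB : IsNode H m B)
    (hw' : IsNode H m w') (hadj : (∃ v, w' = w ++ [v]) ∨ ∃ v, w = w' ++ [v]) :
    w' <+: B ∨ B <+: w' := by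
  rcases h with ⟨⟨t, rfl⟩, hp⟩ | ⟨hBw, hp⟩
  · rcases hadj with ⟨v, rfl⟩ | ⟨v, rfl⟩
    · rcases t with _ | ⟨c, t⟩
      · right; simp
      · left
        have hlen := hp w.length le_rfl (by simp)
        rcases List.eq_nil_or_concat w with rfl | ⟨u, x, rfl⟩
        · simp at hlen
        · have h1 := hw'.const u.length x v (by simpa using hlen) (by simp) (by simp)
          have h2 := hB.const u.length x c (by simpa using hlen) (by simp) (by simp)
          rw [← h1, h2]
          exact ⟨t, by simp⟩
    · left; exact ⟨[v] ++ t, by simp⟩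
  · rcases hadj with ⟨v, rfl⟩ | ⟨v, rfl⟩
    · exact Or.inr (hBw.trans (List.prefix_append _ _))
    · rcases List.prefix_concat_iff.1 hBw with rfl | h
      · exact Or.inl (List.prefix_append _ _)
      · exact Or.inr h

theorem Near.of_adj {B w w' : List V} (h : Near m B w) (hB : IsNode H m B)
    (hw' : IsNode H m w') (hadj : (∃ v, w' = w ++ [v]) ∨ ∃ v, w = w' ++ [v])
    (hd : w' ≠ B → ¬ m ∣ w'.length) : Near m B w' := by
  by_cases hwB : w' = B
  · rw [hwB]; exact near_refl B
  have hd := hd hwB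
  have hc := h.comparable_of_adj hB hw' hadj
  have hlen : w'.length ≤ w.length + 1 ∧ w.length ≤ w'.length + 1 := by
    rcases hadj with ⟨v, rfl⟩ | ⟨v, rfl⟩ <;> simp <;> omega
  have key : ∀ p, (p ≠ w'.length → ¬ m ∣ p) → ¬ m ∣ p := by
    intro p hp
    by_cases h : p = w'.length
    · rw [h]; exact hd
    · exact hp h
  refine hc.imp (fun hc => ⟨hc, fun p h1 h2 => key p fun h3 => ?_⟩)
    fun hc => ⟨hc, fun p h1 h2 => key p fun h3 => ?_⟩ <;>
  rcases h with ⟨hw, hp⟩ | ⟨hw, hp⟩ <;>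
  have hwl := hw.length_le <;> have hcl := hc.length_le
  · exact hp p (by omega) (by omega)
  · omega
  · omega
  · exact hp p (by omega) (by omega)

/-- Small connected graphs that immerse into the path tree are subdivided stars. -/
theorem isStarSubdivision_of_immersion {W : Type u} [Finite W] {K : SimpleGraph W}
    (hK : K.Connected) (f : K →g pathTree H m) (hf : Function.Injective f)
    (hm : Nat.card W ≤ m) : IsStarSubdivision K := by
  classical
  have hu : (K.induce Set.univ).Connected := (SimpleGraph.induceUnivIso K).connected_iff.2 hK
  have hadj : ∀ w w', K.Adj w w' →
      (∃ v, (f w').1 = (f w).1 ++ [v]) ∨ ∃ v, (f w).1 = (f w').1 ++ [v] :=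
    fun w w' h => pathTree_adj.1 (f.map_rel h)
  obtain ⟨b, hnear⟩ : ∃ b, ∀ w, Near m (f b).1 (f w).1 := by
    by_cases hex : ∃ b, m ∣ (f b).1.length
    · obtain ⟨b, hb⟩ := hex
      refine ⟨b, fun w => ?_⟩
      -- Along a walk with fewer than m steps the length of the list changes by less than m. A
      -- second length divisible by m must therefore equal that of b, and comparability forces the
      -- vertex to be b.
      have key : ∀ (u v : W) (p : K.Walk u v), v = b → p.length < m →
          Near m (f b).1 (f u).1 ∧ (f u).1.length ≤ (f b).1.length + p.length ∧
            (f b).1.length ≤ (f u).1.length + p.length := by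
        intro u v p
        induction p with
        | nil =>
          rintro rfl -
          exact ⟨near_refl _, by simp, by simp⟩
        | @cons u u' v h p ih =>
          intro hv hp
          rw [SimpleGraph.Walk.length_cons] at hp
          obtain ⟨h1, h2, h3⟩ := ih hv (by omega)
          have hl : (f u).1.length ≤ (f u').1.length + 1 ∧
              (f u').1.length ≤ (f u).1.length + 1 := by
            rcases hadj u u' h with ⟨v, h⟩ | ⟨v, h⟩ <;> rw [h] <;> simp <;> omega
          have hc := h1.comparable_of_adj (f b).2 (f u).2 (hadj u' u h.symm)
          rw [SimpleGraph.Walk.length_cons]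
          refine ⟨h1.of_adj (f b).2 (f u).2 (hadj u' u h.symm) fun hne hdvd => ?_, by omega,
            by omega⟩
          refine hne (eq_of_comparable hc ?_)
          obtain ⟨x, hx⟩ := hdvd
          obtain ⟨y, hy⟩ := hb
          have hxy : x < y + 1 := lt_of_mul_lt_mul_left
            (by rw [mul_add, mul_one]; omega : m * x < m * (y + 1)) (Nat.zero_le m)
          have hyx : y < x + 1 := lt_of_mul_lt_mul_left
            (by rw [mul_add, mul_one]; omega : m * y < m * (x + 1)) (Nat.zero_le m)
          rw [hx, hy, show x = y by omega]
      have := Fintype.ofFinite W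
      obtain ⟨p, hp⟩ := (hK.preconnected w b).exists_isPath
      refine (key w b p rfl ?_).1
      rw [Nat.card_eq_fintype_card] at hm
      exact hp.length_lt.trans_le hm
    · push Not at hex
      obtain ⟨b⟩ := hK.nonempty
      refine ⟨b, fun w => ?_⟩
      refine subset_of_connected_of_closed (D := {w | Near m (f b).1 (f w).1}) hu
        (Set.mem_univ b) (near_refl _) ?_ (Set.mem_univ w)
      intro y hy z _ hyz
      exact Near.of_adj hy (f b).2 (f z).2 (hadj y z hyz) fun _ => hex z
  have heq : ∀ w, (f w).1.length = (f b).1.length → w = b := fun w h =>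
    hf (Subtype.ext (eq_of_comparable (hnear w).comparable h))
  have hup : ∀ w, (f b).1.length < (f w).1.length →
      (f b).1 <+: (f w).1 ∧ ∀ p, (f b).1.length < p → p ≤ (f w).1.length → ¬ m ∣ p := by
    intro w hw
    refine (hnear w).resolve_left fun h => ?_
    exact absurd h.1.length_le (by omega)
  have hdown : ∀ w, (f w).1.length ≤ (f b).1.length → (f w).1 <+: (f b).1 := by
    intro w hw
    rcases hnear w with h | h
    · exact h.1
    · rw [h.1.eq_of_length (le_antisymm h.1.length_le hw)]
  -- All vertices below b share the branch `none`; those above are told apart by their first entry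
  -- after b, because up to their length every later entry repeats it.
  let br : W → Option V := fun w =>
    if (f w).1.length ≤ (f b).1.length then none else (f w).1[(f b).1.length]?
  let d : W → ℕ := fun w => ((f w).1.length - (f b).1.length) + ((f b).1.length - (f w).1.length)
  have hstep : ∀ w w', (∃ v, (f w').1 = (f w).1 ++ [v]) → w ≠ b → w' ≠ b → br w = br w' := by
    rintro w w' ⟨v, h⟩ hw hw'
    have h1 : (f w).1.length ≠ (f b).1.length := fun h => hw (heq w h)
    have h2 : (f w').1.length = (f w).1.length + 1 := by rw [h]; simp
    by_cases hle : (f w).1.length ≤ (f b).1.length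
    · simp only [br]
      rw [if_pos hle, if_pos (by omega)]
    · simp only [br]
      rw [if_neg hle, if_neg (by omega), h, List.getElem?_append_left (by omega)]
  refine isStarSubdivision_of_coords hK b br d ?_ ?_ ?_
  · refine fun w => ⟨fun h => heq w ?_, fun h => ?_⟩
    · simp only [d] at h; omega
    · simp [d, h]
  · intro w w' hw hw' hbr hd
    have h1 : (f w).1.length ≠ (f b).1.length := fun h => hw (heq w h)
    have h2 : (f w').1.length ≠ (f b).1.length := fun h => hw' (heq w' h)
    simp only [br] at hbr
    simp only [d] at hd
    refine hf (Subtype.ext ?_)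
    by_cases hle : (f w).1.length ≤ (f b).1.length <;>
      by_cases hle' : (f w').1.length ≤ (f b).1.length
    · have hl : (f w).1.length = (f w').1.length := by omega
      exact (List.prefix_of_prefix_length_le (hdown w hle) (hdown w' hle') hl.le).eq_of_length hl
    · rw [if_pos hle, if_neg hle', List.getElem?_eq_getElem (by omega)] at hbr
      cases hbr
    · rw [if_neg hle, if_pos hle', List.getElem?_eq_getElem (by omega)] at hbr
      cases hbr
    · rw [if_neg hle, if_neg hle'] at hbr
      have hl : (f w).1.length = (f w').1.length := by omega
      obtain ⟨⟨t, ht⟩, hp⟩ := hup w (by omega)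
      obtain ⟨⟨t', ht'⟩, -⟩ := hup w' (by omega)
      refine List.ext_getElem? fun k => ?_
      induction k with
      | zero =>
        by_cases hk : 0 < (f b).1.length
        · rw [← ht, ← ht', List.getElem?_append_left hk, List.getElem?_append_left hk]
        · rw [← Nat.eq_zero_of_not_pos hk, hbr]
      | succ k ih =>
        rcases lt_trichotomy (k + 1) (f b).1.length with hk | hk | hk
        · rw [← ht, ← ht', List.getElem?_append_left hk, List.getElem?_append_left hk]
        · rw [hk, hbr]
        · by_cases hkl : k + 1 < (f w).1.length
          · have hnd := hp (k + 1) hk hkl.le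
            have e1 := List.getElem?_eq_getElem (l := (f w).1) (i := k) (by omega)
            have e1' := List.getElem?_eq_getElem (l := (f w).1) (i := k + 1) hkl
            have e2' := List.getElem?_eq_getElem (l := (f w').1) (i := k + 1) (by omega)
            rw [e1', e2', ← (f w).2.const k _ _ hnd e1 e1',
              ← (f w').2.const k _ _ hnd (ih ▸ e1) e2']
          · rw [List.getElem?_eq_none (by omega), List.getElem?_eq_none (by omega)]
  · intro w w' h
    by_cases hw : w = b
    · left
      refine ⟨hw, ?_⟩
      subst hw
      rcases hadj w w' h with ⟨v, h⟩ | ⟨v, h⟩ <;> simp [d, h]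
    by_cases hw' : w' = b
    · right; left
      refine ⟨hw', ?_⟩
      subst hw'
      rcases hadj w w' h with ⟨v, h⟩ | ⟨v, h⟩ <;> simp [d, h]
    right; right
    have h1 : (f w).1.length ≠ (f b).1.length := fun h => hw (heq w h)
    have h2 : (f w').1.length ≠ (f b).1.length := fun h => hw' (heq w' h)
    refine ⟨hw, hw', ?_, ?_⟩
    · rcases hadj w w' h with h | h
      · exact hstep w w' h hw hw'
      · exact (hstep w' w h hw' hw).symm
    · have h3 : (f w').1.length = (f w).1.length + 1 ∨ (f w).1.length = (f w').1.length + 1 := by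
        rcases hadj w w' h with ⟨v, h⟩ | ⟨v, h⟩ <;> simp [h]
      simp only [d]
      omega

end PathTreeSubgraphs

/-! ### Upper and lower bounds for the complexity -/

section Complexity

variable {κ : Cardinal.{u}} {𝒦 : Set BGraph.{u}}

/-- Graphs with the same profile immerse the same small graphs. -/
theorem free_of_captures {m : ℕ} {V W : Type u} [Finite W] {K : SimpleGraph W}
    (hW : Nat.card W ≤ m) {G : SimpleGraph V} {U : LGraph.{u} Unit}
    (hU : Captures (Fin (m + 1)) U G (fun _ => ()) Set.univ) [Nonempty U.V] (hG : K.Free G) :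
    K.Free U.G := by
  rintro ⟨g, hg⟩
  obtain ⟨e⟩ : Nonempty (W ↪ Fin (m + 1)) :=
    -- `Fin (m + 1)` is used so that the set of pattern vertices is nonempty even for m = 0.
    ⟨(Finite.equivFin W).toEmbedding.trans (Fin.castLEEmb (by omega))⟩
  let f : Fin (m + 1) → U.V := Function.extend e g fun _ => Classical.arbitrary _
  have hf : ∀ w, f (e w) = g w := fun w => e.injective.extend_apply _ _ w
  have hp : ((Set.range e, K.map e, fun _ => ()) : Pattern (Fin (m + 1)) Unit) ∈
      U.profile (Fin (m + 1)) := by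
    refine ⟨f, fun _ => trivial, ?_, ?_, fun _ _ => rfl⟩
    · rintro _ ⟨a, rfl⟩ _ ⟨b, rfl⟩ hab
      rw [hf, hf] at hab
      rw [hg hab]
    · rintro _ - _ - ⟨-, a, b, hab, rfl, rfl⟩
      rw [hf, hf]
      exact g.map_rel hab
  rw [hU.2] at hp
  obtain ⟨f', -, hinj, hadj, -⟩ := hp
  refine hG ⟨⟨⟨fun w => f' (e w), fun {a b} hab => ?_⟩, fun a b hab => ?_⟩⟩
  · exact hadj _ ⟨a, rfl⟩ _ ⟨b, rfl⟩ ((SimpleGraph.map_adj_apply (f := e)).2 hab)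
  · exact e.injective (hinj ⟨a, rfl⟩ ⟨b, rfl⟩ hab)

/-- A bound on the ranks occurring in the class yields a strongly universal family. -/
theorem exists_isStronglyUniversal (hκ : ℵ₀ ≤ κ) (h𝒦 : 𝒦.Finite) (hfin : ∀ K ∈ 𝒦, Finite K.V)
    {μ : Cardinal.{u}} (hμ : ℵ₀ ≤ μ) (hμκ : μ ≤ κ) {ι : Type u} (α : ι → Ordinal.{u})
    (hα : ∀ i, (α i).card ≤ μ)
    (h : ∀ H ∈ raylessFreeClass κ 𝒦, ∃ i, RankLT H.G (α i) Set.univ) :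
    ∃ F, IsStronglyUniversal (raylessFreeClass κ 𝒦) F ∧ #F ≤ Cardinal.lift.{u + 1} (#ι * μ) := by
  obtain ⟨m, hm⟩ := (h𝒦.image fun K => Nat.card K.V).bddAbove
  have hm : ∀ K ∈ 𝒦, Nat.card K.V ≤ m := fun K hK => hm ⟨K, hK, rfl⟩
  choose T U hT hU hcap using fun i =>
    hasFamily_rankLT hκ hμ hμκ (M := Fin (m + 1)) (α i) (hα i) Unit
  let B : (Σ i, T i) → BGraph.{u} := fun p => ⟨(U p.1 p.2).V, (U p.1 p.2).G⟩
  -- Only those graphs of the family that lie in the class are kept. A graph capturing a member of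
  -- the class survives, since equal profiles mean the same excluded immersions.
  refine ⟨{H | H ∈ raylessFreeClass κ 𝒦 ∧ H ∈ Set.range B}, ⟨fun H hH => hH.1, ?_⟩, ?_⟩
  · rintro H hH
    obtain ⟨i, hi⟩ := h H hH
    have hc : (H.G.induce Set.univ).Connected :=
      (SimpleGraph.induceUnivIso H.G).connected_iff.2 hH.1.1
    obtain ⟨t, ht⟩ := hcap i H.V H.G (fun _ => ()) Set.univ hc
      (by rw [Cardinal.mk_univ]; exact hH.1.2.2) hi
    have hg := hU i t
    refine ⟨B ⟨i, t⟩, ⟨⟨⟨hg.conn, hg.rayless, hg.card⟩, fun K hK => ?_⟩, ⟨i, t⟩, rfl⟩, ?_⟩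
    · have := hfin K hK
      have := hg.conn.nonempty
      exact free_of_captures (hm K hK) ht (hH.2 K hK)
    · obtain ⟨φ, -⟩ := ht.1
      exact ⟨(SimpleGraph.induceUnivIso H.G).symm.toEmbedding.trans φ⟩
  · refine (Cardinal.mk_le_mk_of_subset (t := Set.range B) fun H hH => hH.2).trans ?_
    have h1 := Cardinal.mk_range_le_lift (f := B)
    rw [Cardinal.lift_id'.{u, u + 1}] at h1
    refine h1.trans (Cardinal.lift_le.2 ?_)
    rw [Cardinal.mk_sigma]
    refine (Cardinal.sum_le_mk_mul_iSup _).trans ?_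
    gcongr
    exact ciSup_le' hT

/-- If no member of `𝒦` is a disjoint union of subdivided stars, no family of at most `κ` graphs
is universal. -/
theorem le_mk_of_isStronglyUniversal (hκ : ℵ₀ ≤ κ) (h𝒦 : 𝒦.Finite) (hfin : ∀ K ∈ 𝒦, Finite K.V)
    (hstar : ∀ K ∈ 𝒦, ¬ ∀ c : K.G.ConnectedComponent, IsStarSubdivision c.toSimpleGraph)
    {F : Set BGraph.{u}} (hF : IsStronglyUniversal (raylessFreeClass κ 𝒦) F) :
    Cardinal.lift.{u + 1} (Order.succ κ) ≤ #F := by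
  by_contra hlt
  rw [not_le, Cardinal.lift_succ, Order.lt_succ_iff] at hlt
  obtain ⟨g⟩ : Nonempty (F ↪ κ.out) := by
    rw [← Cardinal.lift_mk_le', Cardinal.mk_out, Cardinal.lift_id'.{u, u + 1}]
    exact hlt
  have : Small.{u} F := small_of_injective g.injective
  have hι : #(Shrink.{u} F) ≤ κ := by
    have := Cardinal.mk_le_of_injective (((equivShrink F).symm.toEmbedding.trans g).injective)
    rwa [Cardinal.mk_out] at this
  obtain ⟨m, hm⟩ := (h𝒦.image fun K => Nat.card K.V).bddAbove
  have hm : ∀ K ∈ 𝒦, Nat.card K.V ≤ m := fun K hK => hm ⟨K, hK, rfl⟩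
  let E : Shrink.{u} F → F := (equivShrink F).symm
  -- All second labels are false, so the assembly is the disjoint union of the members of `F` with
  -- one isolated vertex.
  let C : Shrink.{u} F → LGraph.{u} (Unit × Prop) := fun j =>
    ⟨(E j).1.V, (E j).1.G, fun _ => ((), False)⟩
  have hC : ∀ j, (E j).1 ∈ raylessClass κ := fun j => (hF.1 (E j).2).1
  let D : LGraph.{u} Unit := assemble () C
  have hD : IsRayless D.G := assemble_rayless _ C fun j => (hC j).2.1
  have hDc : #D.V ≤ κ := assemble_card _ C hκ hι fun j => (hC j).2.2
  -- The multiplicity m + 1 is positive and at least the order of every excluded graph, so an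
  -- immersed member of `𝒦` would have only subdivided stars as components.
  obtain ⟨H, hHF, ⟨φ⟩⟩ := hF.2 ⟨_, pathTree D.G (m + 1)⟩ ⟨⟨pathTree_connected,
    pathTree_rayless hD (Nat.succ_pos m), pathTree_card hκ hDc⟩, fun K hK => by
      rintro ⟨f, hf⟩
      have := hfin K hK
      refine hstar K hK fun c => isStarSubdivision_of_immersion c.connected_toSimpleGraph
        (f.comp ⟨Subtype.val, fun {a b} hab => hab⟩) (hf.comp Subtype.val_injective) ?_
      refine (Nat.card_le_card_of_injective _ Subtype.val_injective).trans
        ((hm K hK).trans (Nat.le_succ m))⟩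
  obtain ⟨j, hj⟩ := (equivShrink F).symm.surjective ⟨H, hHF⟩
  have hj : (E j).1 = H := congrArg Subtype.val hj
  subst hj
  refine pathTree_free hD (Nat.succ_pos m) ⟨⟨⟨fun w => some ⟨j, φ w⟩, fun {a b} hab => ?_⟩, ?_⟩⟩
  · exact (assemble_adj_some () C j _ _).2 (φ.map_rel_iff.2 hab)
  · intro a b hab
    have := eq_of_heq (Sigma.mk.inj (Option.some.inj hab)).2
    exact φ.injective this

end Complexity

end RaylessGraphs

theorem mainTheorem3 (κ : Cardinal.{u}) (hκ : Cardinal.aleph0 ≤ κ)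
    (𝒦 : Set RaylessGraphs.BGraph.{u}) (h𝒦 : 𝒦.Finite) (hfin : ∀ K ∈ 𝒦, Finite K.V) :
    ((∀ K ∈ 𝒦, ¬ ∀ c : K.G.ConnectedComponent,
        RaylessGraphs.IsStarSubdivision c.toSimpleGraph) →
      RaylessGraphs.IsStrongComplexity (RaylessGraphs.raylessFreeClass κ 𝒦)
        (Cardinal.lift.{u + 1} (Order.succ κ))) ∧
    ((∃ K ∈ 𝒦, ∀ c : K.G.ConnectedComponent,
        RaylessGraphs.IsStarSubdivision c.toSimpleGraph) →
      ∃ c : Cardinal.{u + 1}, c ≤ Cardinal.aleph0 ∧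
        RaylessGraphs.IsStrongComplexity (RaylessGraphs.raylessFreeClass κ 𝒦) c) := by
  constructor
  · intro hstar
    obtain ⟨F, hF, hFc⟩ := RaylessGraphs.exists_isStronglyUniversal hκ h𝒦 hfin hκ le_rfl
      -- One family for each rank bound below κ⁺; each such ordinal has cardinality at most κ, so κ⁺
      -- · κ = κ⁺ graphs arise.
      (ι := (Order.succ κ).ord.ToType) (fun i => (i.toOrd : Ordinal.{u}))
      (fun i => Order.lt_succ_iff.1 (Cardinal.lt_ord.1 i.toOrd.2)) (by
        intro H hH
        obtain ⟨α, hα, hr⟩ := RaylessGraphs.exists_rankLT_of_rayless hκ hH.1.2.1 hH.1.2.2 Set.univ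
          ((SimpleGraph.induceUnivIso H.G).connected_iff.2 hH.1.1)
        exact ⟨Ordinal.ToType.mk ⟨α, hα⟩, by simpa using hr⟩)
    refine ⟨⟨F, hF, le_antisymm (hFc.trans (Cardinal.lift_le.2 ?_))
      (RaylessGraphs.le_mk_of_isStronglyUniversal hκ h𝒦 hfin hstar hF)⟩, ?_⟩
    · rw [Cardinal.mk_toType, Cardinal.card_ord]
      exact Cardinal.mul_le_of_le (hκ.trans (Order.le_succ κ)) le_rfl (Order.le_succ κ)
    · rintro d ⟨F', hF', rfl⟩
      exact RaylessGraphs.le_mk_of_isStronglyUniversal hκ h𝒦 hfin hstar hF'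
  · rintro ⟨K, hK, hc⟩
    obtain ⟨F, hF, hFc⟩ := RaylessGraphs.exists_isStronglyUniversal hκ h𝒦 hfin le_rfl hκ
      (ι := PUnit) (fun _ => Ordinal.omega0 + Ordinal.omega0) (by simp) (by
        intro H hH
        have := hfin K hK
        exact ⟨⟨⟩, RaylessGraphs.rankLT_of_free_stars hc (hH.2 K hK) hH.1.2.1 hH.1.1⟩)
    let S : Set Cardinal.{u + 1} := {d | ∃ F : Set RaylessGraphs.BGraph.{u},
      RaylessGraphs.IsStronglyUniversal (RaylessGraphs.raylessFreeClass κ 𝒦) F ∧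
        Cardinal.mk F = d}
    have hS : Cardinal.mk F ∈ S := ⟨F, hF, rfl⟩
    -- Cardinals are well-ordered, so the least size of a strongly universal family is attained.
    refine ⟨sInf S, (csInf_le' hS).trans ?_, csInf_mem ⟨_, hS⟩, fun d hd => csInf_le' hd⟩
    simpa using hFc
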